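/- Let $\hat{\mathfrak{sl}}_2=\mathfrak{sl}_2\otimes\mathbb C[t,t^{-1}]\oplus\mathbb C K$ be the affine Lie algebra with $[x_m,y_n]=[x,y]_{m+n}+m\,\mathrm{tr}(xy)\,\delta_{m+n,0}K$, where $x_n=x\otimes t^n$ and $e,h,f$ is the standard basis of $\mathfrak{sl}_2$, and let $\mathcal L=\bigoplus_{s\in\mathbb Z}\mathbb C L_s\oplus\mathbb C C$ be the Virasoro algebra with $[L_m,L_n]=(m-n)L_{m+n}+\frac{m^3-m}{12}\delta_{m+n,0}C$. Let $k\in\mathbb C\setminus\{-2\}$ and $\mu,c\in\mathbb C$, and put $$h=\frac{\mu(3\mu+2-2k)}{4(k+2)}.$$ Let $M_k(\mu)$ be the Verma module of level $k$ for $\hat{\mathfrak{sl}}_2$, generated by a vector $v$ with $h_0v=\mu v$, $Kv=kv$, $e_0v=0$ and $x_nv=0$ for $x\in\mathfrak{sl}_2$, $n\ge 1$. Let $M^-_k(-\mu)$ be the lowest-weight Verma module, generated by a vector $v^-$ with $h_0v^-=-\mu v^-$, $Kv^-=kv^-$, $f_0v^-=0$ and $x_nv^-=0$ for $x\in\mathfrak{sl}_2$,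 $n\ge1$. Let $M_{\mathrm{Vir}}(c,h)$ be the Verma module for $\mathcal L$, generated by a vector $w$ with $L_0w=hw$, $Cw=cw$ and $L_sw=0$ for $s\ge1$. On the affine modules let $L_0$ be the Sugawara operator $$L_0=\frac{1}{2(k+2)}\Bigl(e_0f_0+f_0e_0+\tfrac12h_0^2+2\sum_{n\ge1}\bigl(e_{-n}f_n+f_{-n}e_n+\tfrac12h_{-n}h_n\bigr)\Bigr).$$ The vectors $\prod_{i\ge1}(e_{-i})^{k_i}(h_{-i})^{l_i}(f_{-i})^{m_i}(f_0)^nv$, where $(k_i),(l_i),(m_i)$ run over the finitely supported sequences in $\mathbb Z_{\ge0}$ and $n$ over $\mathbb Z_{\ge0}$, form a basis of $M_k(\mu)$ (factors with smaller $i$ stand to the left), and the linear map $\varphi^+\colon M_k(\mu)\to M_{\mathrm{Vir}}(c,h)$ with $$\prod_{i\ge1}(e_{-i})^{k_i}(h_{-i})^{l_i}(f_{-i})^{m_i}(f_0)^nv\ \longmapsto\ \prod_{i\ge1}(L_{-3i+1})^{k_i}(L_{-3i})^{l_i}(L_{-3i-1})^{m_i}(L_{-1})^nw$$ is an isomorphism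 of vector spaces. It maps vectors of $(h_0,L_0)$-weight $(f,n)$ to vectors of $L_0$-weight $-f/2+3n$. Likewise, the vectors $\prod_{i\ge1}(f_{-i})^{k_i}(h_{-i})^{l_i}(e_{-i})^{m_i}(e_0)^nv^-$ form a basis of $M^-_k(-\mu)$, and the linear map $\varphi^-\colon M^-_k(-\mu)\to M_{\mathrm{Vir}}(c,h)$ sending each of them to $\prod_{i\ge1}(L_{-3i+1})^{k_i}(L_{-3i})^{l_i}(L_{-3i-1})^{m_i}(L_{-1})^nw$ is an isomorphism of vector spaces. It maps vectors of $(h_0,L_0)$-weight $(f,n)$ to vectors of $L_0$-weight $f/2+3n$. On $M_k(\mu)$ and $M_k^-(-\mu)$ the operators $h_0,L_0$ are simultaneously diagonalisable with finite-dimensional joint eigenspaces, and on $M_{\mathrm{Vir}}(c,h)$ the operator $L_0$ is diagonalisable with finite-dimensional eigenspaces. The formal characters $\mathrm{ch}_M(w,q)=\mathrm{tr}_M\,q^{L_0}w^{h_0}$ and $\mathrm{ch}_M(q)=\mathrm{tr}_M\,q^{L_0}$ (formal sums of monomials with complex exponents) satisfy $$\mathrm{ch}_{M_k(\mu)}(q^{-1/2},q^3)=\mathrm{ch}_{M_{\mathrm{Vir}}(c,h)}(q)=\mathrm{ch}_{M^-_k(-\mu)}(q^{1/2},q^3),$$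 where both substitutions are well defined, i.e. only finitely many monomials contribute to each power of $q$. -/

import Mathlib

noncomputable section

open scoped TensorProduct

namespace AffVir

/-! ### The Lie algebra `sl₂` and its affinisation -/

/-- The complex Lie algebra `sl₂` of traceless `2 × 2` matrices. -/
abbrev Sl2 : Type := LieAlgebra.SpecialLinear.sl (Fin 2) ℂ

/-- `e` is the strictly upper triangular matrix unit. -/
def sl2E : Sl2 := ⟨!![0, 1; 0, 0], LinearMap.mem_ker.2 (by simp [Matrix.trace_fin_two])⟩

/-- `h = diag(1, -1)`. -/
def sl2H : Sl2 := ⟨!![1, 0; 0, -1], LinearMap.mem_ker.2 (by simp [Matrix.trace_fin_two])⟩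

/-- `f` is the strictly lower triangular matrix unit. -/
def sl2F : Sl2 := ⟨!![0, 0; 1, 0], LinearMap.mem_ker.2 (by simp [Matrix.trace_fin_two])⟩

/-- The normalised invariant form `(x, y) ↦ tr(xy)` on `sl₂`. -/
def sl2Form : LinearMap.BilinForm ℂ Sl2 :=
  LinearMap.mk₂ ℂ (fun x y => Matrix.trace (x.1 * y.1))
    (fun x y z => by simp [add_mul])
    (fun a x y => by simp)
    (fun x y z => by simp [mul_add])
    (fun a x y => by simp)

theorem sl2Form_apply (x y : Sl2) : sl2Form x y = Matrix.trace (x.1 * y.1) := rfl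

theorem neg_sl2Form_lieInvariant : (-sl2Form).lieInvariant Sl2 := by
  intro x y z
  simp only [LinearMap.neg_apply, sl2Form_apply, LieAlgebra.SpecialLinear.sl_bracket, sub_mul,
    mul_sub, Matrix.trace_sub, neg_sub]
  rw [Matrix.mul_assoc y.1 x.1 z.1, Matrix.mul_assoc x.1 y.1 z.1,
    Matrix.trace_mul_comm x.1 (y.1 * z.1), Matrix.mul_assoc]

theorem neg_sl2Form_isSymm : (-sl2Form).IsSymm :=
  ⟨fun x y => by
    simp only [LinearMap.neg_apply, sl2Form_apply]
    rw [Matrix.trace_mul_comm]⟩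

/-- The loop algebra `sl₂ ⊗ ℂ[t, t⁻¹]`. -/
abbrev LoopSl2 : Type := LieAlgebra.loopAlgebra ℂ ℤ Sl2

/-- The cocycle of the affine Lie algebra. Mathlib's cocycle attached to a form `Φ` sends
`(x tᵐ, y tⁿ)` to `n Φ(x, y) δ_{m+n,0}`, so that the form `-tr(xy)` gives the usual
`m tr(xy) δ_{m+n,0}`; see `lie_mode_mode`. -/
def affineCocycle : LieModule.Cohomology.twoCocycle ℂ LoopSl2 (TrivialLieModule ℂ LoopSl2 ℂ) :=
  LieAlgebra.LoopAlgebra.twoCocycleOfBilinear ℂ ℤ Sl2 (-sl2Form)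
    neg_sl2Form_lieInvariant neg_sl2Form_isSymm

/-- The affine Lie algebra `ŝl₂ = sl₂ ⊗ ℂ[t, t⁻¹] ⊕ ℂ K`. -/
abbrev AffineSl2 : Type := LieAlgebra.ofTwoCocycle affineCocycle

/-- The mode `xₙ = x ⊗ tⁿ`. -/
def mode (x : Sl2) (n : ℤ) : AffineSl2 :=
  LieAlgebra.ofProd affineCocycle (AddMonoidAlgebra.single n (1 : ℂ) ⊗ₜ[ℂ] x, 0)

/-- The central element `K`. -/
def centralK : AffineSl2 :=
  LieAlgebra.ofProd affineCocycle (0, (TrivialLieModule.equiv ℂ LoopSl2 ℂ).symm 1)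

theorem residuePairing_single (x y : Sl2) (m n : ℤ) :
    LieAlgebra.LoopAlgebra.residuePairing ℂ ℤ Sl2 (-sl2Form)
      (AddMonoidAlgebra.single m (1 : ℂ) ⊗ₜ[ℂ] x) (AddMonoidAlgebra.single n (1 : ℂ) ⊗ₜ[ℂ] y) =
      if m + n = 0 then (m : ℂ) * Matrix.trace (x.1 * y.1) else 0 := by
  rw [LieAlgebra.LoopAlgebra.residuePairing_apply_apply,
    LieAlgebra.LoopAlgebra.toFinsupp_single_tmul, LieAlgebra.LoopAlgebra.toFinsupp_single_tmul,
    Finsupp.sum_single_index (by simp)]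
  split_ifs with h
  · obtain rfl : n = -m := by omega
    rw [neg_neg, Finsupp.single_eq_same, LinearMap.neg_apply, LinearMap.neg_apply, sl2Form_apply,
      neg_smul, smul_neg, neg_neg, zsmul_eq_mul]
  · rw [Finsupp.single_eq_of_ne (by omega), map_zero, LinearMap.zero_apply, smul_zero]

/-- The commutation relation `[xₘ, yₙ] = [x, y]ₘ₊ₙ + m tr(xy) δ_{m+n,0} K`. -/
theorem lie_mode_mode (x y : Sl2) (m n : ℤ) :
    ⁅mode x m, mode y n⁆ =
      mode ⁅x, y⁆ (m + n) +
        (if m + n = 0 then (m : ℂ) * Matrix.trace (x.1 * y.1) else 0) • centralK := by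
  rw [mode, mode, LieAlgebra.bracket_ofTwoCocycle, mode, centralK, ← LieAlgebra.of_smul,
    ← LieAlgebra.of_add]
  congr 1
  refine Prod.ext ?_ ?_
  · rw [Prod.fst_add, Prod.smul_fst, smul_zero, add_zero]
    change ⁅AddMonoidAlgebra.single m (1 : ℂ) ⊗ₜ[ℂ] x, AddMonoidAlgebra.single n (1 : ℂ) ⊗ₜ[ℂ] y⁆ = _
    rw [LieAlgebra.ExtendScalars.bracket_tmul, AddMonoidAlgebra.single_mul_single, mul_one]
  · rw [Prod.snd_add, Prod.smul_snd, zero_add, ← residuePairing_single, ← map_smul, smul_eq_mul,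
      mul_one]
    simp only [trivial_lie_zero, add_zero, sub_zero]
    rfl

theorem lie_centralK (x : AffineSl2) : ⁅x, centralK⁆ = 0 := by
  rw [centralK, LieAlgebra.bracket_ofTwoCocycle, ← LieAlgebra.of_zero]
  congr 1
  simp [trivial_lie_zero]


/-! ### The Virasoro algebra -/

/-- The underlying vector space `⨁ₛ ℂ Lₛ ⊕ ℂ C` of the Virasoro algebra. -/
def Virasoro : Type := (ℤ →₀ ℂ) × ℂ

namespace Virasoro

instance : AddCommGroup Virasoro := inferInstanceAs (AddCommGroup ((ℤ →₀ ℂ) × ℂ))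

instance : Module ℂ Virasoro := inferInstanceAs (Module ℂ ((ℤ →₀ ℂ) × ℂ))

/-- The basis element `Lₛ`. -/
def L (s : ℤ) : Virasoro := ((Finsupp.single s 1, 0) : (ℤ →₀ ℂ) × ℂ)

/-- The central element `C`. -/
def C : Virasoro := ((0, 1) : (ℤ →₀ ℂ) × ℂ)

/-- The projection to the span of the `Lₛ`. -/
def fst : Virasoro →ₗ[ℂ] (ℤ →₀ ℂ) := LinearMap.fst ℂ (ℤ →₀ ℂ) ℂ

/-- The bracket on the span of the `Lₛ`, the bilinear extension of
`[Lₘ, Lₙ] = (m - n) Lₘ₊ₙ + (m³ - m)/12 δ_{m+n,0} C`. -/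
def bracketAux : (ℤ →₀ ℂ) →ₗ[ℂ] (ℤ →₀ ℂ) →ₗ[ℂ] Virasoro :=
  Finsupp.linearCombination ℂ fun m : ℤ => Finsupp.linearCombination ℂ fun n : ℤ =>
    ((m : ℂ) - n) • L (m + n) + (if m + n = 0 then ((m : ℂ) ^ 3 - m) / 12 else 0) • C

@[simp] theorem fst_L (s : ℤ) : fst (L s) = Finsupp.single s 1 := rfl

@[simp] theorem fst_C : fst C = 0 := rfl

theorem bracketAux_single (m n : ℤ) :
    bracketAux (Finsupp.single m 1) (Finsupp.single n 1) =
      ((m : ℂ) - n) • L (m + n) + (if m + n = 0 then ((m : ℂ) ^ 3 - m) / 12 else 0) • C := by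
  simp [bracketAux]

theorem bracketAux_skew (x y : ℤ →₀ ℂ) : bracketAux x y = -bracketAux y x := by
  have h : bracketAux = -bracketAux.flip := by
    ext m n : 4
    simp only [LinearMap.coe_comp, Function.comp_apply, Finsupp.lsingle_apply,
      LinearMap.neg_apply, LinearMap.flip_apply, bracketAux_single]
    rw [neg_add, ← neg_smul, ← neg_smul, add_comm n m]
    congr 2
    · ring
    · split_ifs with h
      · obtain rfl : n = -m := by omega
        push_cast; ring
      · simp
  exact LinearMap.congr_fun₂ h x y

theorem bracketAux_jacobi (x y z : ℤ →₀ ℂ) :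
    bracketAux x (fst (bracketAux y z)) =
      bracketAux (fst (bracketAux x y)) z + bracketAux y (fst (bracketAux x z)) := by
  induction x using Finsupp.induction_linear with
  | zero => simp
  | add x x' hx hx' => simp only [map_add, LinearMap.add_apply, hx, hx']; abel
  | single l a =>
  induction y using Finsupp.induction_linear with
  | zero => simp
  | add x x' hx hx' => simp only [map_add, hx, hx', LinearMap.add_apply]; abel
  | single m b =>
  induction z using Finsupp.induction_linear with
  | zero => simp
  | add x x' hx hx' => simp only [map_add, hx, hx']; abel
  | single n c =>
  have e (i : ℤ) (r : ℂ) : Finsupp.single i r = r • Finsupp.single i (1 : ℂ) := by simp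
  rw [e l a, e m b, e n c]
  simp only [map_smul, LinearMap.smul_apply, bracketAux_single, map_add, fst_L, fst_C, smul_zero,
    add_zero]
  rw [show l + (m + n) = l + m + n by ring, show m + (l + n) = l + m + n by ring]
  split_ifs with h
  · obtain rfl : n = -l - m := by omega
    push_cast
    module
  · push_cast
    module

theorem bracketAux_self (x : ℤ →₀ ℂ) : bracketAux x x = 0 := by
  have h : (2 : ℂ) • bracketAux x x = 0 := by
    rw [two_smul]
    nth_rewrite 1 [bracketAux_skew]
    exact neg_add_cancel _
  exact (smul_eq_zero.mp h).resolve_left two_ne_zero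

instance : LieRing Virasoro where
  bracket x y := bracketAux (fst x) (fst y)
  add_lie x y z := by simp
  lie_add x y z := by simp
  lie_self x := bracketAux_self (fst x)
  leibniz_lie x y z := bracketAux_jacobi (fst x) (fst y) (fst z)

instance : LieAlgebra ℂ Virasoro where
  lie_smul a x y := by
    change bracketAux (fst x) (fst (a • y)) = a • bracketAux (fst x) (fst y)
    simp

theorem lie_L_L (m n : ℤ) :
    ⁅L m, L n⁆ =
      ((m : ℂ) - n) • L (m + n) + (if m + n = 0 then ((m : ℂ) ^ 3 - m) / 12 else 0) • C :=
  bracketAux_single m n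

theorem lie_C (x : Virasoro) : ⁅x, C⁆ = 0 := by
  change bracketAux (fst x) (fst C) = 0
  simp

end Virasoro

/-! ### Modules and Verma modules -/

section Action

variable (g : Type) [LieRing g] [LieAlgebra ℂ g] (M : Type) [AddCommGroup M] [Module ℂ M]
  [Module (UniversalEnvelopingAlgebra ℂ g) M]
  [IsScalarTower ℂ (UniversalEnvelopingAlgebra ℂ g) M]

/-- The linear operator by which an element of the Lie algebra acts on a module over the universal
enveloping algebra. -/
def act (x : g) : Module.End ℂ M :=
  Algebra.lsmul ℂ ℂ M (UniversalEnvelopingAlgebra.ι ℂ x)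

variable {g} in
/-- The module generated by one vector `v` subject to the relations `x v = a v` for `(x, a) ∈ S`:
the quotient of the universal enveloping algebra by the left ideal generated by the elements
`x - a` with `(x, a) ∈ S`. -/
abbrev CyclicModule (S : Set (g × ℂ)) : Type :=
  UniversalEnvelopingAlgebra ℂ g ⧸
    Submodule.span (UniversalEnvelopingAlgebra ℂ g)
      ((fun p : g × ℂ => UniversalEnvelopingAlgebra.ι ℂ p.1 -
        algebraMap ℂ (UniversalEnvelopingAlgebra ℂ g) p.2) '' S)

variable {g} in
/-- The canonical generator of a cyclic module. -/
def CyclicModule.gen (S : Set (g × ℂ)) : CyclicModule S := Submodule.Quotient.mk 1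

end Action

/-- A module over the affine Lie algebra is smooth if every vector is annihilated by all modes `xₙ`
with `n` large enough. -/
class IsSmooth (M : Type) [AddCommGroup M] [Module ℂ M]
    [Module (UniversalEnvelopingAlgebra ℂ AffineSl2) M]
    [IsScalarTower ℂ (UniversalEnvelopingAlgebra ℂ AffineSl2) M] : Prop where
  eventually_zero : ∀ (x : Sl2) (v : M), ∃ N : ℕ, ∀ n : ℕ, N ≤ n → act AffineSl2 M (mode x n) v = 0

/-- The relations of the highest-weight vector of `M_k(μ)`: it is annihilated by `e₀` and by
`sl₂ ⊗ t ℂ[t]`, while `h₀` acts by `μ` and `K` by `k`. -/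
def highestRelations (k μ : ℂ) : Set (AffineSl2 × ℂ) :=
  {(centralK, k), (mode sl2H 0, μ), (mode sl2E 0, 0)} ∪
    {p | ∃ (x : Sl2) (n : ℕ), p = (mode x (n + 1), 0)}

/-- The relations of the lowest-weight vector of `M⁻_k(ν)`: it is annihilated by `f₀` and by
`sl₂ ⊗ t ℂ[t]`, while `h₀` acts by `ν` and `K` by `k`. -/
def lowestRelations (k ν : ℂ) : Set (AffineSl2 × ℂ) :=
  {(centralK, k), (mode sl2H 0, ν), (mode sl2F 0, 0)} ∪
    {p | ∃ (x : Sl2) (n : ℕ), p = (mode x (n + 1), 0)}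

/-- The Verma module `M_k(μ)` of level `k` and highest weight `μ` of the affine Lie algebra, induced
from the one-dimensional module `ℂ_μ` of the standard Borel subalgebra. -/
abbrev AffineVerma (k μ : ℂ) : Type := CyclicModule (highestRelations k μ)

/-- The lowest-weight Verma module `M⁻_k(ν)` of level `k` and lowest weight `ν`. -/
abbrev AffineVermaLowest (k ν : ℂ) : Type := CyclicModule (lowestRelations k ν)

/-- The relations of the highest-weight vector of `M_Vir(c, h)`: `Lₛ` with `s > 0` annihilates it,
`L₀` acts by `h` and `C` by `c`. -/
def virasoroRelations (c h : ℂ) : Set (Virasoro × ℂ) :=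
  {(Virasoro.C, c), (Virasoro.L 0, h)} ∪ {p | ∃ n : ℕ, p = (Virasoro.L (n + 1), 0)}

/-- The Verma module `M_Vir(c, h)` of the Virasoro algebra. -/
abbrev VirasoroVerma (c h : ℂ) : Type := CyclicModule (virasoroRelations c h)

/-- The affine Lie algebra is spanned by the modes and `K`. -/
theorem affine_induction {P : AffineSl2 → Prop} (hmode : ∀ x n, P (mode x n)) (hK : P centralK)
    (hadd : ∀ x y, P x → P y → P (x + y)) (hsmul : ∀ (a : ℂ) x, P x → P (a • x))
    (y : AffineSl2) : P y := by
  have h0 : P 0 := by simpa using hsmul 0 _ hK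
  have h1 : ∀ u : LoopSl2, P (LieAlgebra.ofProd affineCocycle (u, 0)) := by
    intro u
    induction u using TensorProduct.induction_on with
    | zero => exact h0
    | add u v hu hv =>
      have := hadd _ _ hu hv
      rwa [← LieAlgebra.of_add, Prod.mk_add_mk, add_zero] at this
    | tmul r x =>
      induction r using AddMonoidAlgebra.induction_linear with
      | zero => rw [TensorProduct.zero_tmul]; exact h0
      | add r s hr hs =>
        have := hadd _ _ hr hs
        rwa [← LieAlgebra.of_add, Prod.mk_add_mk, add_zero, ← TensorProduct.add_tmul] at this
      | single n a =>
        have := hsmul a _ (hmode x n)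
        rw [mode, ← LieAlgebra.of_smul, Prod.smul_mk, smul_zero, TensorProduct.smul_tmul'] at this
        rwa [AddMonoidAlgebra.smul_single, smul_eq_mul, mul_one] at this
  obtain ⟨u, a⟩ := y
  have h2 := hadd _ _ (h1 u) (hsmul (TrivialLieModule.equiv ℂ LoopSl2 ℂ a) _ hK)
  rw [centralK, ← LieAlgebra.of_smul, ← LieAlgebra.of_add, Prod.smul_mk, smul_zero, ← map_smul,
    smul_eq_mul, mul_one, LinearEquiv.symm_apply_apply, Prod.mk_add_mk, add_zero, zero_add] at h2
  exact h2

section Smooth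

attribute [local instance 100] LieRing.ofAssociativeRing

theorem universalEnveloping_induction {g : Type} [LieRing g] [LieAlgebra ℂ g]
    {P : UniversalEnvelopingAlgebra ℂ g → Prop} (halg : ∀ a : ℂ, P (algebraMap ℂ _ a))
    (hι : ∀ x : g, P (UniversalEnvelopingAlgebra.ι ℂ x)) (hadd : ∀ x y, P x → P y → P (x + y))
    (hmul : ∀ x y, P x → P y → P (x * y)) (u : UniversalEnvelopingAlgebra ℂ g) : P u := by
  let A : Subalgebra ℂ (UniversalEnvelopingAlgebra ℂ g) :=
    { carrier := {u | P u}
      mul_mem' := fun {x y} hx hy => hmul x y hx hy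
      add_mem' := fun {x y} hx hy => hadd x y hx hy
      algebraMap_mem' := halg }
  let j : g →ₗ⁅ℂ⁆ A :=
    { toFun := fun x => ⟨UniversalEnvelopingAlgebra.ι ℂ x, hι x⟩
      map_add' := fun x y => Subtype.ext (map_add _ x y)
      map_smul' := fun a x => Subtype.ext (map_smul _ a x)
      map_lie' := fun {x y} => Subtype.ext (LieHom.map_lie _ x y) }
  have h : A.val.comp (UniversalEnvelopingAlgebra.lift ℂ j) = AlgHom.id ℂ _ := by
    apply UniversalEnvelopingAlgebra.hom_ext
    ext x
    simp [j]
  have := (UniversalEnvelopingAlgebra.lift ℂ j u).2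
  have hu : ((UniversalEnvelopingAlgebra.lift ℂ j u : A) : UniversalEnvelopingAlgebra ℂ g) = u :=
    AlgHom.congr_fun h u
  rwa [hu] at this

theorem isSmooth_cyclicModule (S : Set (AffineSl2 × ℂ))
    (hS : ∀ (x : Sl2) (n : ℕ), (mode x (n + 1), (0 : ℂ)) ∈ S) : IsSmooth (CyclicModule S) := by
  have hact (z : AffineSl2) (v : CyclicModule S) :
      act AffineSl2 (CyclicModule S) z v = UniversalEnvelopingAlgebra.ι ℂ z • v := rfl
  let Q : CyclicModule S → Prop := fun v => ∀ x : Sl2, ∃ N : ℕ, ∀ n : ℕ, N ≤ n →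
    UniversalEnvelopingAlgebra.ι ℂ (mode x n) • v = 0
  have hQadd : ∀ v w, Q v → Q w → Q (v + w) := fun v w hv hw x => by
    obtain ⟨N₁, h₁⟩ := hv x
    obtain ⟨N₂, h₂⟩ := hw x
    exact ⟨N₁ + N₂, fun n hn => by
      rw [smul_add, h₁ n (by omega), h₂ n (by omega), add_zero]⟩
  have hcomm (z y : AffineSl2) (v : CyclicModule S) :
      UniversalEnvelopingAlgebra.ι ℂ z • UniversalEnvelopingAlgebra.ι ℂ y • v =
        UniversalEnvelopingAlgebra.ι ℂ y • UniversalEnvelopingAlgebra.ι ℂ z • v +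
          UniversalEnvelopingAlgebra.ι ℂ ⁅z, y⁆ • v := by
    rw [LieHom.map_lie, LieRing.of_associative_ring_bracket, sub_smul, mul_smul, mul_smul]
    abel
  have hQι : ∀ (y : AffineSl2) v, Q v → Q (UniversalEnvelopingAlgebra.ι ℂ y • v) := by
    intro y v hv
    induction y using affine_induction with
    | hadd y y' hy hy' => rw [map_add, add_smul]; exact hQadd _ _ hy hy'
    | hsmul a y hy =>
      intro x
      obtain ⟨N, h⟩ := hy x
      refine ⟨N, fun n hn => ?_⟩
      rw [map_smul, smul_assoc, smul_comm, h n hn, smul_zero]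
    | hK =>
      intro x
      obtain ⟨N, h⟩ := hv x
      refine ⟨N, fun n hn => ?_⟩
      rw [hcomm, lie_centralK, h n hn, smul_zero, map_zero, zero_smul, add_zero]
    | hmode y j =>
      intro x
      obtain ⟨N₁, h₁⟩ := hv x
      obtain ⟨N₂, h₂⟩ := hv ⁅x, y⁆
      refine ⟨N₁ + N₂ + j.natAbs + 1, fun n hn => ?_⟩
      have hpos : (n : ℤ) + j = ((n + j).toNat : ℕ) := by omega
      rw [hcomm, h₁ n (by omega), smul_zero, zero_add, lie_mode_mode, if_neg (by omega), zero_smul,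
        add_zero, hpos, h₂ _ (by omega)]
  have hQu : ∀ (u : UniversalEnvelopingAlgebra ℂ AffineSl2) v, Q v → Q (u • v) := by
    intro u
    induction u using universalEnveloping_induction with
    | halg a =>
      intro v hv x
      obtain ⟨N, h⟩ := hv x
      exact ⟨N, fun n hn => by rw [algebraMap_smul, smul_comm, h n hn, smul_zero]⟩
    | hι y => exact hQι y
    | hadd u u' hu hu' => intro v hv; rw [add_smul]; exact hQadd _ _ (hu v hv) (hu' v hv)
    | hmul u u' hu hu' => intro v hv; rw [mul_smul]; exact hu _ (hu' v hv)
  have hgen : Q (CyclicModule.gen S) := fun x => ⟨1, fun n hn => by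
    obtain ⟨n, rfl⟩ : ∃ m, n = m + 1 := ⟨n - 1, by omega⟩
    rw [CyclicModule.gen, ← Submodule.Quotient.mk_smul, Submodule.Quotient.mk_eq_zero]
    refine Submodule.subset_span ⟨_, hS x n, ?_⟩
    simp⟩
  refine ⟨fun x v => ?_⟩
  obtain ⟨u, rfl⟩ := Submodule.Quotient.mk_surjective _ v
  have h := hQu u _ hgen x
  rw [CyclicModule.gen, ← Submodule.Quotient.mk_smul, smul_eq_mul, mul_one] at h
  exact h

end Smooth

instance (k μ : ℂ) : IsSmooth (AffineVerma k μ) :=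
  isSmooth_cyclicModule _ fun x n => Or.inr ⟨x, n, rfl⟩

instance (k ν : ℂ) : IsSmooth (AffineVermaLowest k ν) :=
  isSmooth_cyclicModule _ fun x n => Or.inr ⟨x, n, rfl⟩

/-! ### The operator `L₀`, weight spaces and characters -/

section Affine

variable (k : ℂ) (M : Type) [AddCommGroup M] [Module ℂ M]
  [Module (UniversalEnvelopingAlgebra ℂ AffineSl2) M]
  [IsScalarTower ℂ (UniversalEnvelopingAlgebra ℂ AffineSl2) M]

/-- The operator `e₋ₙ fₙ + f₋ₙ eₙ + ½ h₋ₙ hₙ`. -/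
def sugawaraTerm (n : ℕ) : Module.End ℂ M :=
  act AffineSl2 M (mode sl2E (-n)) * act AffineSl2 M (mode sl2F n) +
    act AffineSl2 M (mode sl2F (-n)) * act AffineSl2 M (mode sl2E n) +
    (1 / 2 : ℂ) • (act AffineSl2 M (mode sl2H (-n)) * act AffineSl2 M (mode sl2H n))

variable [IsSmooth M]

theorem sugawaraTerm_finite (v : M) :
    (Function.support fun n : ℕ => sugawaraTerm M (n + 1) v).Finite := by
  obtain ⟨N₁, h₁⟩ := IsSmooth.eventually_zero sl2E v
  obtain ⟨N₂, h₂⟩ := IsSmooth.eventually_zero sl2F v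
  obtain ⟨N₃, h₃⟩ := IsSmooth.eventually_zero sl2H v
  refine (Set.finite_Iio (N₁ + N₂ + N₃)).subset fun n hn => ?_
  by_contra hlt
  rw [Set.mem_Iio, not_lt] at hlt
  refine hn ?_
  simp only [sugawaraTerm, LinearMap.add_apply, LinearMap.smul_apply, Module.End.mul_apply,
    h₁ (n + 1) (by omega), h₂ (n + 1) (by omega), h₃ (n + 1) (by omega), map_zero, smul_zero,
    add_zero]

/-- The Sugawara operator `L₀` on a smooth module of level `k ≠ -2`:
`L₀ = 1/(2(k+2)) (e₀f₀ + f₀e₀ + ½h₀² + 2 ∑_{n ≥ 1} (e₋ₙ fₙ + f₋ₙ eₙ + ½ h₋ₙ hₙ))`, where only finitely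
many terms of the sum do not annihilate a given vector. -/
def sugawaraL0 : Module.End ℂ M :=
  (1 / (2 * (k + 2))) •
    (sugawaraTerm M 0 + (2 : ℂ) •
      { toFun := fun v => ∑ᶠ n : ℕ, sugawaraTerm M (n + 1) v
        map_add' := fun v w => by
          simp only [map_add]
          exact finsum_add_distrib (sugawaraTerm_finite M v) (sugawaraTerm_finite M w)
        map_smul' := fun a v => by
          simp only [map_smul, RingHom.id_apply]
          exact (smul_finsum' a (sugawaraTerm_finite M v)).symm })

/-- The space of vectors of `(h₀, L₀)`-weight `(f, n)`. -/
def affineWeightSpace (f n : ℂ) : Submodule ℂ M :=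
  (act AffineSl2 M (mode sl2H 0)).eigenspace f ⊓ (sugawaraL0 k M).eigenspace n

/-- The Jacobi character `tr_M q^{L₀} w^{h₀}` is defined: `h₀` and `L₀` are simultaneously
diagonalisable with finite-dimensional simultaneous eigenspaces. -/
def HasAffineCharacter : Prop :=
  (⨆ p : ℂ × ℂ, affineWeightSpace k M p.1 p.2) = ⊤ ∧
    ∀ f n : ℂ, FiniteDimensional ℂ (affineWeightSpace k M f n)

/-- The Jacobi character `ch_M(w, q) = tr_M q^{L₀} w^{h₀}`, as the family of the coefficients of the
formal monomials `w^f q^n` with `f, n ∈ ℂ`. -/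
def affineCharacter : ℂ → ℂ → ℕ :=
  fun f n => Module.finrank ℂ (affineWeightSpace k M f n)

end Affine

section Vir

variable (M : Type) [AddCommGroup M] [Module ℂ M]
  [Module (UniversalEnvelopingAlgebra ℂ Virasoro) M]
  [IsScalarTower ℂ (UniversalEnvelopingAlgebra ℂ Virasoro) M]

/-- The space of vectors of `L₀`-weight `n`. -/
def virasoroWeightSpace (n : ℂ) : Submodule ℂ M :=
  (act Virasoro M (Virasoro.L 0)).eigenspace n

/-- The character `tr_M q^{L₀}` is defined: `L₀` is diagonalisable with finite-dimensional
eigenspaces. -/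
def HasVirasoroCharacter : Prop :=
  (⨆ n : ℂ, virasoroWeightSpace M n) = ⊤ ∧
    ∀ n : ℂ, FiniteDimensional ℂ (virasoroWeightSpace M n)

/-- The character `ch_M(q) = tr_M q^{L₀}`, as the family of the coefficients of the formal monomials
`q^n` with `n ∈ ℂ`. -/
def virasoroCharacter : ℂ → ℕ :=
  fun n => Module.finrank ℂ (virasoroWeightSpace M n)

end Vir

/-- The substitution `w ↦ q^a`, `q ↦ q^b` is defined for the formal sum `∑ ch f n • w^f q^n`: only
finitely many of its monomials contribute to any given power of `q`. -/
def CanSubstitute (ch : ℂ → ℂ → ℕ) (a b : ℂ) : Prop :=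
  ∀ m : ℂ, {p : ℂ × ℂ | a * p.1 + b * p.2 = m ∧ ch p.1 p.2 ≠ 0}.Finite

/-- The formal sum `ch(q^a, q^b)`: its coefficient at `q^m` is the sum of the coefficients of `ch` at
all monomials `w^f q^n` with `a f + b n = m`. -/
def substitute (ch : ℂ → ℂ → ℕ) (a b : ℂ) : ℂ → ℕ :=
  fun m => ∑ᶠ (p : ℂ × ℂ) (_ : a * p.1 + b * p.2 = m), ch p.1 p.2

/-! ### The Poincaré-Birkhoff-Witt monomials and the maps `φ⁺` and `φ⁻` -/

/-- The exponents of a monomial: finite sequences `(kᵢ)`, `(lᵢ)`, `(mᵢ)`, `i ≥ 1`, and a number `n`.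
The entry with index `i` of the sequences is stored at `i - 1`. -/
structure Exponents where
  /-- the exponents `kᵢ₊₁` -/
  k : ℕ →₀ ℕ
  /-- the exponents `lᵢ₊₁` -/
  l : ℕ →₀ ℕ
  /-- the exponents `mᵢ₊₁` -/
  m : ℕ →₀ ℕ
  /-- the last exponent -/
  n : ℕ

/-- A bound beyond which all exponents vanish. -/
def Exponents.bound (p : Exponents) : ℕ :=
  (p.k.support ∪ p.l.support ∪ p.m.support).sup Nat.succ

/-- The product `(∏_{i ≥ 0} X(i)^{kᵢ₊₁} Y(i)^{lᵢ₊₁} Z(i)^{mᵢ₊₁}) Wⁿ`, in which the factors with smaller `i`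
stand further to the left. -/
def orderedProduct {A : Type} [Ring A] (X Y Z : ℕ → A) (W : A) (p : Exponents) : A :=
  ((List.range p.bound).map fun i => X i ^ p.k i * Y i ^ p.l i * Z i ^ p.m i).prod * W ^ p.n

/-- The image of `xₙ` in the universal enveloping algebra of the affine Lie algebra. -/
def affineU (x : Sl2) (n : ℤ) : UniversalEnvelopingAlgebra ℂ AffineSl2 :=
  UniversalEnvelopingAlgebra.ι ℂ (mode x n)

/-- The image of `Lₛ` in the universal enveloping algebra of the Virasoro algebra. -/
def virasoroU (s : ℤ) : UniversalEnvelopingAlgebra ℂ Virasoro :=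
  UniversalEnvelopingAlgebra.ι ℂ (Virasoro.L s)

/-- The vector `∏_{i ≥ 1} (e₋ᵢ)^{kᵢ} (h₋ᵢ)^{lᵢ} (f₋ᵢ)^{mᵢ} (f₀)ⁿ v` of `M_k(μ)`. -/
def affineMonomial (k μ : ℂ) (p : Exponents) : AffineVerma k μ :=
  orderedProduct (fun i => affineU sl2E (-(i + 1))) (fun i => affineU sl2H (-(i + 1)))
    (fun i => affineU sl2F (-(i + 1))) (affineU sl2F 0) p • CyclicModule.gen (highestRelations k μ)

/-- The vector `∏_{i ≥ 1} (f₋ᵢ)^{kᵢ} (h₋ᵢ)^{lᵢ} (e₋ᵢ)^{mᵢ} (e₀)ⁿ v` of `M⁻_k(ν)`. -/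
def affineMonomialLowest (k ν : ℂ) (p : Exponents) : AffineVermaLowest k ν :=
  orderedProduct (fun i => affineU sl2F (-(i + 1))) (fun i => affineU sl2H (-(i + 1)))
    (fun i => affineU sl2E (-(i + 1))) (affineU sl2E 0) p • CyclicModule.gen (lowestRelations k ν)

/-- The vector `∏_{i ≥ 1} (L₋₃ᵢ₊₁)^{kᵢ} (L₋₃ᵢ)^{lᵢ} (L₋₃ᵢ₋₁)^{mᵢ} (L₋₁)ⁿ w` of `M_Vir(c, h)`. -/
def virasoroMonomial (c h : ℂ) (p : Exponents) : VirasoroVerma c h :=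
  orderedProduct (fun i => virasoroU (-3 * (i + 1) + 1)) (fun i => virasoroU (-3 * (i + 1)))
    (fun i => virasoroU (-3 * (i + 1) - 1)) (virasoroU (-1)) p •
      CyclicModule.gen (virasoroRelations c h)

end AffVir

end

/-! The theorem rests on a Poincaré-Birkhoff-Witt basis for all three Verma modules and on one
identity between the weights of their generators. Once the ordered monomials are known to form bases
indexed by the same `Exponents`, `φ⁺` and `φ⁻` are bijections between bases.

The weights match because `[h₀, e₋ᵢ] = 2e₋ᵢ`, `[h₀, f₋ᵢ] = -2f₋ᵢ` and `[L₀, x₋ᵢ] = i x₋ᵢ`. So under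
`-h₀/2 + 3L₀` the factors `e₋ᵢ, h₋ᵢ, f₋ᵢ, f₀` have weights `3i-1, 3i, 3i+1, 1`, which are the
`L₀`-weights of their images (`Triple.varDegree_eq`). The formula for `h` is `-μ/2 + 3Δ` with `Δ =
μ(μ+2)/(4(k+2))` the Sugawara weight of `v`. Exchanging `e` and `f` and negating `h₀` gives the
lowest-weight case; `Triple` treats both at once.

The bases come from `IsInduced.basis`, which covers any Lie algebra spanned by variables `xᵢ` and a
complementary subalgebra with a character. An action of `g` is built on the space of commutative
monomials, and `IsInduced.monAct_lie` shows that it is a representation. Acting on the monomial `1`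
then separates the ordered monomials modulo the left ideal, so they are independent; equivariance
shows that they span.

The commutator `[L₀, x₋ₙ] = n x₋ₙ` is `sugawaraL0_md`. It is computed directly for `e₀`, `f₀`,
`h₋₁`, which generate all the modes needed. Joint eigenspaces are then spanned by basis monomials
(`eigenspace_eq_basisSpan`). All finiteness follows from the finiteness of the number of partitions,
and the character identity counts monomials of a given degree by joint weight. -/

noncomputable section

open scoped TensorProduct

namespace AffVir

/-! ### Modules induced from a character: a Poincaré-Birkhoff-Witt basis -/

section Induced

variable {N : Type} [LinearOrder N] {g : Type} [LieRing g] [LieAlgebra ℂ g]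

/-- The vector space with basis the monomials in variables indexed by `N`. -/
abbrev Monomials (N : Type) : Type := Multiset N →₀ ℂ

/-- The basis vector of `Monomials N` attached to a multiset. -/
abbrev mon (s : Multiset N) : Monomials N := Finsupp.single s 1

/-- The span of the monomials of degree less than `d`. -/
def degLT (N : Type) (d : ℕ) : Submodule ℂ (Monomials N) :=
  Finsupp.supported ℂ ℂ {s : Multiset N | s.card < d}

omit [LinearOrder N] in
theorem mon_mem_degLT {s : Multiset N} {d : ℕ} (h : s.card < d) : mon s ∈ degLT N d :=
  Finsupp.single_mem_supported ℂ 1 h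

omit [LinearOrder N] in
theorem degLT_mono {d e : ℕ} (h : d ≤ e) : degLT N d ≤ degLT N e :=
  Finsupp.supported_mono fun s (hs : s.card < d) => show s.card < e by omega

omit [LinearOrder N] in
theorem degLT_le {d : ℕ} {W : Submodule ℂ (Monomials N)}
    (h : ∀ s : Multiset N, s.card < d → mon s ∈ W) : degLT N d ≤ W := by
  rw [degLT, Finsupp.supported_eq_span_single, Submodule.span_le]
  rintro _ ⟨s, hs, rfl⟩
  exact h s hs

omit [LinearOrder N] in
theorem degLT_induction {d : ℕ} {W : Type} [AddCommGroup W] [Module ℂ W]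
    {f f' : Monomials N →ₗ[ℂ] W} (h : ∀ s : Multiset N, s.card < d → f (mon s) = f' (mon s))
    {v : Monomials N} (hv : v ∈ degLT N d) : f v = f' v :=
  degLT_le (W := LinearMap.eqLocus f f') h hv

/-- Splitting off a minimal element is the recursion pattern of ordered monomials: the smallest
variable is the leftmost factor. -/
theorem multiset_min_induction {P : Multiset N → Prop} (s : Multiset N) (h0 : P 0)
    (hcons : ∀ (j : N) (t : Multiset N), (∀ i ∈ t, j ≤ i) → P (j ::ₘ t)) : P s := by
  rw [← Multiset.sort_eq s (· ≤ ·)]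
  have hs := Multiset.pairwise_sort s (· ≤ ·)
  cases h : s.sort (· ≤ ·) with
  | nil => exact h0
  | cons j t =>
    rw [h, List.pairwise_cons] at hs
    exact hcons j t fun i hi => hs.1 i hi

/-- Multiplication of monomials by a linear combination of the variables. -/
def mulVar : (N →₀ ℂ) →ₗ[ℂ] Monomials N →ₗ[ℂ] Monomials N :=
  Finsupp.linearCombination ℂ fun i => Finsupp.lmapDomain ℂ ℂ (i ::ₘ ·)

omit [LinearOrder N] in
@[simp] theorem mulVar_single (i : N) (s : Multiset N) :
    mulVar (Finsupp.single i 1) (mon s) = mon (i ::ₘ s) := by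
  simp [mulVar]

omit [LinearOrder N] in
theorem mulVar_mem (a : N →₀ ℂ) {d : ℕ} {v : Monomials N} (hv : v ∈ degLT N d) :
    mulVar a v ∈ degLT N (d + 1) := by
  induction a using Finsupp.induction_linear with
  | zero => simp
  | add a b ha hb => rw [map_add]; exact add_mem ha hb
  | single i r =>
    refine degLT_le (W := (degLT N (d + 1)).comap (mulVar (Finsupp.single i r))) ?_ hv
    intro s hs
    rw [Submodule.mem_comap, ← mul_one r, ← smul_eq_mul, ← Finsupp.smul_single, map_smul,
      LinearMap.smul_apply, mulVar_single]
    exact Submodule.smul_mem _ _ (mon_mem_degLT (by simpa using hs))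

/-! ### Recursive construction of the action of `g` on monomials. -/

variable (x : N → g) (π : g →ₗ[ℂ] N →₀ ℂ) (χ : g →ₗ[ℂ] ℂ)

/-- The projection of `g` that annihilates `xᵢ` for `i ≤ j`. -/
def trunc (j : N) : g →ₗ[ℂ] g :=
  LinearMap.id - (Finsupp.linearCombination ℂ fun i => if i ≤ j then x i else 0) ∘ₗ π

/-- One step of the recursion for `corr`. -/
def corrStep (c : g →ₗ[ℂ] Monomials N →ₗ[ℂ] Monomials N) :
    g →ₗ[ℂ] Monomials N →ₗ[ℂ] Monomials N :=
  LinearMap.flip <| Finsupp.linearCombination ℂ fun s : Multiset N =>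
    match s.sort (· ≤ ·) with
    | [] => χ.smulRight (mon 0)
    -- The aim is `y · xⱼt = xⱼ(y · t) + [y, xⱼ] · t`. The variables `xᵢ` with `i ≤ j` go in front
    -- without correction, so `trunc` removes them from `y`. For what remains, the commutative part
    -- of `y · t` yields the commutative part of `y · xⱼt`. The correction is therefore `xⱼ` applied
    -- to the correction of `y · t`, plus the bracket term, where the full action is `mulVar ∘ₗ π +
    -- c`.
    | j :: t =>
      ((mulVar ∘ₗ π + c) (x j) ∘ₗ c.flip (mon (t : Multiset N)) +
        (mulVar ∘ₗ π + c).flip (mon (t : Multiset N)) ∘ₗ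
          (LieModule.toEnd ℂ g g : g →ₗ[ℂ] Module.End ℂ g).flip (x j)) ∘ₗ trunc x π j

/-- The difference between the action of `g` on monomials and the multiplication by variables,
correct on monomials of degree less than `d`. -/
def corr : ℕ → g →ₗ[ℂ] Monomials N →ₗ[ℂ] Monomials N
  | 0 => 0
  | d + 1 => corrStep x π χ (corr d)

theorem corrStep_zero (c : g →ₗ[ℂ] Monomials N →ₗ[ℂ] Monomials N) (y : g) :
    corrStep x π χ c y (mon 0) = χ y • mon 0 := by
  rw [corrStep, LinearMap.flip_apply, Finsupp.linearCombination_single, one_smul,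
    Multiset.sort_zero]
  rfl

theorem corrStep_cons (c : g →ₗ[ℂ] Monomials N →ₗ[ℂ] Monomials N) (y : g) {j : N}
    {t : Multiset N} (h : ∀ i ∈ t, j ≤ i) :
    corrStep x π χ c y (mon (j ::ₘ t)) =
      mulVar (π (x j)) (c (trunc x π j y) (mon t)) + c (x j) (c (trunc x π j y) (mon t)) +
        (mulVar (π ⁅trunc x π j y, x j⁆) (mon t) + c ⁅trunc x π j y, x j⁆ (mon t)) := by
  rw [corrStep, LinearMap.flip_apply, Finsupp.linearCombination_single, one_smul,
    Multiset.sort_cons _ _ _ h]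
  simp [Multiset.sort_eq]

/-- Up to terms that do not raise the degree, the action is commutative multiplication. This makes
the recursion well founded, since the correction is applied twice in a row. -/
theorem corr_mem (d : ℕ) (y : g) {n : ℕ} {v : Monomials N} (hv : v ∈ degLT N n) :
    corr x π χ d y v ∈ degLT N n := by
  induction d generalizing y n v with
  | zero => simp [corr]
  | succ d ih =>
    refine degLT_le (W := (degLT N n).comap (corr x π χ (d + 1) y)) ?_ hv
    intro s
    rw [Submodule.mem_comap, corr]
    induction s using multiset_min_induction with
    | h0 =>
      intro hs
      rw [corrStep_zero]
      exact Submodule.smul_mem _ _ (mon_mem_degLT hs)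
    | hcons j t h =>
      intro hs
      rw [Multiset.card_cons] at hs
      obtain ⟨n, rfl⟩ : ∃ m, n = m + 1 := ⟨n - 1, by omega⟩
      have ht : mon t ∈ degLT N n := mon_mem_degLT (by omega)
      rw [corrStep_cons x π χ _ y h]
      exact add_mem (add_mem (mulVar_mem _ (ih _ ht)) (ih _ (ih _ (degLT_mono (by omega) ht))))
        (add_mem (mulVar_mem _ ht) (ih _ (degLT_mono (by omega) ht)))

/-- The recursion stabilises: the value on a monomial only uses values on vectors of degree at most
that of the monomial with one factor removed. -/
theorem corr_succ (d : ℕ) (y : g) {v : Monomials N} (hv : v ∈ degLT N d) :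
    corr x π χ (d + 1) y v = corr x π χ d y v := by
  induction d generalizing y v with
  | zero => exact degLT_induction (fun s hs => absurd hs (by omega)) hv
  | succ d ih =>
    refine degLT_induction (fun s => ?_) hv
    change s.card < d + 1 → corrStep x π χ (corr x π χ (d + 1)) y (mon s) =
      corrStep x π χ (corr x π χ d) y (mon s)
    induction s using multiset_min_induction with
    | h0 => intro; rw [corrStep_zero, corrStep_zero]
    | hcons j t h =>
      intro hs
      rw [Multiset.card_cons] at hs
      have ht : mon t ∈ degLT N d := mon_mem_degLT (by omega)
      rw [corrStep_cons x π χ _ y h, corrStep_cons x π χ _ y h, ih _ ht, ih _ ht,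
        ih _ (corr_mem x π χ _ _ ht)]

theorem corr_of_le {d e : ℕ} (h : d ≤ e) (y : g) {v : Monomials N} (hv : v ∈ degLT N d) :
    corr x π χ e y v = corr x π χ d y v := by
  induction e, h using Nat.le_induction with
  | base => rfl
  | succ e he ih => rw [corr_succ x π χ e y (degLT_mono he hv), ih]

/-- The action of `g` on monomials. -/
def monAct : g →ₗ[ℂ] Monomials N →ₗ[ℂ] Monomials N :=
  -- The depth `s.card + 1` is the first at which `corr` is correct on `s`.
  mulVar ∘ₗ π + LinearMap.flip (Finsupp.linearCombination ℂ fun s : Multiset N =>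
    (corr x π χ (s.card + 1)).flip (mon s))

theorem monAct_of_mem (d : ℕ) (y : g) {v : Monomials N} (hv : v ∈ degLT N d) :
    monAct x π χ y v = mulVar (π y) v + corr x π χ d y v := by
  refine degLT_induction (f' := mulVar (π y) + corr x π χ d y) (fun s hs => ?_) hv
  simp only [monAct, LinearMap.add_apply, LinearMap.coe_comp, Function.comp_apply,
    LinearMap.flip_apply, Finsupp.linearCombination_single, one_smul]
  rw [corr_of_le x π χ (show s.card + 1 ≤ d from hs) y (mon_mem_degLT (Nat.lt_succ_self _))]

theorem monAct_sub_mem (d : ℕ) (y : g) {v : Monomials N} (hv : v ∈ degLT N d) :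
    monAct x π χ y v - mulVar (π y) v ∈ degLT N d := by
  rw [monAct_of_mem x π χ d y hv, add_sub_cancel_left]
  exact corr_mem x π χ d y hv

theorem monAct_zero (y : g) : monAct x π χ y (mon 0) = mulVar (π y) (mon 0) + χ y • mon 0 := by
  rw [monAct_of_mem x π χ 1 y (mon_mem_degLT (by simp)), corr, corrStep_zero]

/-- The recursion freed of its depth parameter, with the correction written as action minus
commutative multiplication. -/
theorem monAct_cons (y : g) {j : N} {t : Multiset N} (h : ∀ i ∈ t, j ≤ i) :
    monAct x π χ y (mon (j ::ₘ t)) = mulVar (π y) (mon (j ::ₘ t)) +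
      (monAct x π χ (x j) (monAct x π χ (trunc x π j y) (mon t) -
        mulVar (π (trunc x π j y)) (mon t)) + monAct x π χ ⁅trunc x π j y, x j⁆ (mon t)) := by
  have ht : mon t ∈ degLT N (t.card + 1) := mon_mem_degLT (by simp)
  rw [monAct_of_mem x π χ (t.card + 1 + 1) y (mon_mem_degLT (by simp)), corr,
    corrStep_cons x π χ _ y h,
    monAct_of_mem x π χ (t.card + 1) (x j) (monAct_sub_mem x π χ _ _ ht),
    monAct_of_mem x π χ (t.card + 1) _ ht,
    monAct_of_mem x π χ (t.card + 1) _ ht, add_sub_cancel_left]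

/-- The data of a Lie algebra `g`, elements `xᵢ` with coordinate functions `π`, and relations
`y v = χ(y) v` for a one-dimensional representation of a complementary subalgebra. -/
structure IsInduced (S : Set (g × ℂ)) : Prop where
  coord_var : ∀ i, π (x i) = Finsupp.single i 1
  coord_rel : ∀ p ∈ S, π p.1 = 0
  char_rel : ∀ p ∈ S, χ p.1 = p.2
  char_var : ∀ i, χ (x i) = 0
  -- By the coordinate conditions and `span_eq_top`, the kernel of `π` is the span of the first
  -- components of `S`. The two bracket conditions make it a subalgebra on which `χ` is a
  -- one-dimensional representation.
  coord_lie : ∀ p ∈ S, ∀ q ∈ S, π ⁅p.1, q.1⁆ = 0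
  char_lie : ∀ p ∈ S, ∀ q ∈ S, χ ⁅p.1, q.1⁆ = 0
  span_eq_top : Submodule.span ℂ (Set.range x ∪ Prod.fst '' S) = ⊤

/-! ### The action on monomials is a representation. -/

variable {x π χ} {S : Set (g × ℂ)} (H : IsInduced x π χ S)

include H

omit [LinearOrder N] in
theorem IsInduced.ext_of_gen {W : Type} [AddCommGroup W] [Module ℂ W] {f f' : g →ₗ[ℂ] W}
    (hvar : ∀ i, f (x i) = f' (x i)) (hrel : ∀ p ∈ S, f p.1 = f' p.1) : f = f' := by
  refine LinearMap.ext_on H.span_eq_top ?_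
  rintro _ (⟨i, rfl⟩ | ⟨p, hp, rfl⟩)
  · exact hvar i
  · exact hrel p hp

theorem IsInduced.trunc_var (i j : N) : trunc x π j (x i) = if i ≤ j then 0 else x i := by
  simp only [trunc, LinearMap.sub_apply, LinearMap.id_apply, LinearMap.coe_comp,
    Function.comp_apply, H.coord_var, Finsupp.linearCombination_single, one_smul]
  split_ifs <;> simp

theorem IsInduced.trunc_rel {p : g × ℂ} (hp : p ∈ S) (j : N) : trunc x π j p.1 = p.1 := by
  simp [trunc, H.coord_rel p hp]

/-- There is no correction, because `trunc` at the smallest index of `s` kills `xᵢ` and `χ` vanishes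
on the variables. -/
theorem IsInduced.monAct_var {i : N} {s : Multiset N} (h : ∀ j ∈ s, i ≤ j) :
    monAct x π χ (x i) (mon s) = mon (i ::ₘ s) := by
  induction s using multiset_min_induction with
  | h0 => rw [monAct_zero, H.coord_var, mulVar_single, H.char_var, zero_smul, add_zero]
  | hcons j t ht =>
    rw [monAct_cons x π χ _ ht, H.trunc_var, if_pos (h j (Multiset.mem_cons_self _ _)),
      H.coord_var, mulVar_single]
    simp

theorem IsInduced.monAct_var_of_cons {i : N} {s : Multiset N} (h : ∀ j ∈ s, i ≤ j) {k : N}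
    (hk : i ≤ k) : monAct x π χ (x i) (mon (k ::ₘ s)) = mon (i ::ₘ k ::ₘ s) :=
  H.monAct_var fun j hj => by
    rcases Multiset.mem_cons.1 hj with rfl | hj
    exacts [hk, h j hj]

/-- The part of the representation property that the recursion builds in, checked on the spanning
set of `g`. -/
theorem IsInduced.monAct_var_comm {j : N} {t : Multiset N} (h : ∀ i ∈ t, j ≤ i) (y : g) :
    monAct x π χ y (monAct x π χ (x j) (mon t)) =
      monAct x π χ (x j) (monAct x π χ y (mon t)) + monAct x π χ ⁅y, x j⁆ (mon t) := by
  -- For `i > j` the truncation leaves `xᵢ` unchanged, and the two copies of the commutative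
  -- monomial `xᵢxⱼt` cancel. The case `i < j` follows by antisymmetry of the bracket.
  have key {i j : N} (hij : j < i) (h : ∀ i ∈ t, j ≤ i) :
      monAct x π χ (x i) (monAct x π χ (x j) (mon t)) =
        monAct x π χ (x j) (monAct x π χ (x i) (mon t)) + monAct x π χ ⁅x i, x j⁆ (mon t) := by
    rw [H.monAct_var h, monAct_cons x π χ _ h, H.trunc_var, if_neg hij.not_ge, H.coord_var,
      mulVar_single, mulVar_single, map_sub, H.monAct_var_of_cons h hij.le, Multiset.cons_swap i j]
    abel
  suffices hs : (monAct x π χ).flip (monAct x π χ (x j) (mon t)) =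
      monAct x π χ (x j) ∘ₗ (monAct x π χ).flip (mon t) +
        (monAct x π χ).flip (mon t) ∘ₗ (LieModule.toEnd ℂ g g : g →ₗ[ℂ] Module.End ℂ g).flip (x j)
    from LinearMap.congr_fun hs y
  refine H.ext_of_gen (fun i => ?_) fun p hp => ?_
  · change monAct x π χ (x i) (monAct x π χ (x j) (mon t)) =
      monAct x π χ (x j) (monAct x π χ (x i) (mon t)) + monAct x π χ ⁅x i, x j⁆ (mon t)
    rcases lt_trichotomy i j with hij | rfl | hij
    · rw [key hij fun k hk => hij.le.trans (h k hk), ← lie_skew (x j) (x i), map_neg,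
        LinearMap.neg_apply]
      abel
    · rw [lie_self, map_zero, LinearMap.zero_apply, add_zero]
    · exact key hij h
  · change monAct x π χ p.1 (monAct x π χ (x j) (mon t)) =
      monAct x π χ (x j) (monAct x π χ p.1 (mon t)) + monAct x π χ ⁅p.1, x j⁆ (mon t)
    rw [H.monAct_var h, monAct_cons x π χ _ h, H.trunc_rel hp, H.coord_rel p hp, map_zero,
      LinearMap.zero_apply, LinearMap.zero_apply, zero_add, sub_zero]

/-- Relative to a minimal index `k`, a generator either can stand in front, or its commutative part
keeps `k` minimal, or it has no commutative part. -/
theorem IsInduced.gen_cases (k : N) {a : g} (ha : a ∈ Set.range x ∪ Prod.fst '' S) :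
    (∃ i ≤ k, a = x i) ∨ (∃ i, k ≤ i ∧ π a = Finsupp.single i 1) ∨ π a = 0 := by
  rcases ha with ⟨i, rfl⟩ | ⟨p, hp, rfl⟩
  · rcases le_total i k with h | h
    · exact Or.inl ⟨i, h, rfl⟩
    · exact Or.inr (Or.inl ⟨i, h, H.coord_var i⟩)
  · exact Or.inr (Or.inr (H.coord_rel p hp))

omit [LinearOrder N] in
theorem IsInduced.eq_of_gen {W : Type} [AddCommGroup W] [Module ℂ W] {f f' : g →ₗ[ℂ] W}
    (h : ∀ a ∈ Set.range x ∪ Prod.fst '' S, f a = f' a) (y : g) : f y = f' y :=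
  LinearMap.congr_fun (LinearMap.ext_on H.span_eq_top h) y

/-- The heart of the construction, by induction on the degree. By linearity both elements may be
taken among the generators. If one is a variable that can stand in front of the monomial,
`monAct_var_comm` suffices; otherwise the smallest variable is pulled out and the Jacobi identity
finishes. -/
theorem IsInduced.monAct_lie_of_mem (d : ℕ) (y z : g) {v : Monomials N} (hv : v ∈ degLT N d) :
    monAct x π χ y (monAct x π χ z v) =
      monAct x π χ z (monAct x π χ y v) + monAct x π χ ⁅y, z⁆ v := by
  induction d generalizing y z v with
  | zero =>
    refine degLT_induction (f := monAct x π χ y ∘ₗ monAct x π χ z)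
      (f' := monAct x π χ z ∘ₗ monAct x π χ y + monAct x π χ ⁅y, z⁆)
      (fun s hs => absurd hs (by omega)) hv
  | succ d ih =>
    refine degLT_induction (f := monAct x π χ y ∘ₗ monAct x π χ z)
      (f' := monAct x π χ z ∘ₗ monAct x π χ y + monAct x π χ ⁅y, z⁆)
      (fun s hs => ?_) hv
    change monAct x π χ y (monAct x π χ z (mon s)) =
      monAct x π χ z (monAct x π χ y (mon s)) + monAct x π χ ⁅y, z⁆ (mon s)
    refine H.eq_of_gen (f := (monAct x π χ).flip (monAct x π χ z (mon s)))
      (f' := monAct x π χ z ∘ₗ (monAct x π χ).flip (mon s) + (monAct x π χ).flip (mon s) ∘ₗ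
        (LieModule.toEnd ℂ g g : g →ₗ[ℂ] Module.End ℂ g).flip z) (fun a ha => ?_) y
    refine H.eq_of_gen (f := monAct x π χ a ∘ₗ (monAct x π χ).flip (mon s))
      (f' := (monAct x π χ).flip (monAct x π χ a (mon s)) + (monAct x π χ).flip (mon s) ∘ₗ
        (LieModule.toEnd ℂ g g : g →ₗ[ℂ] Module.End ℂ g) a) (fun b hb => ?_) z
    change monAct x π χ a (monAct x π χ b (mon s)) =
      monAct x π χ b (monAct x π χ a (mon s)) + monAct x π χ ⁅a, b⁆ (mon s)
    have left {i : N} (hi : ∀ j ∈ s, i ≤ j) : monAct x π χ (x i) (monAct x π χ b (mon s)) =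
        monAct x π χ b (monAct x π χ (x i) (mon s)) + monAct x π χ ⁅x i, b⁆ (mon s) := by
      rw [H.monAct_var_comm hi, ← lie_skew b (x i), map_neg, LinearMap.neg_apply]
      abel
    induction s using multiset_min_induction with
    | h0 =>
      rcases ha with ⟨i, rfl⟩ | ⟨p, hp, rfl⟩
      · exact left (by simp)
      rcases hb with ⟨i, rfl⟩ | ⟨q, hq, rfl⟩
      · exact H.monAct_var_comm (by simp) _
      simp only [monAct_zero, H.coord_rel p hp, H.coord_rel q hq, H.coord_lie p hp q hq,
        H.char_lie p hp q hq, map_zero, LinearMap.zero_apply, zero_add, map_smul, zero_smul,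
        add_zero]
      rw [smul_comm]
    | hcons k t h =>
      rw [Multiset.card_cons] at hs
      have hmin {i : N} (hi : i ≤ k) : ∀ j ∈ k ::ₘ t, i ≤ j := fun j hj => by
        rcases Multiset.mem_cons.1 hj with rfl | hj
        exacts [hi, hi.trans (h j hj)]
      have ht : mon t ∈ degLT N d := mon_mem_degLT (by omega)
      -- The degree of `c · t` may be too large for the induction hypothesis, but only through its
      -- leading monomial. There `k` is still minimal, so `monAct_var_comm` applies; the remainder
      -- falls under the induction hypothesis.
      have hcomm {c : g} (hc : (∃ i, k ≤ i ∧ π c = Finsupp.single i 1) ∨ π c = 0) (y : g) :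
          monAct x π χ y (monAct x π χ (x k) (monAct x π χ c (mon t))) =
            monAct x π χ (x k) (monAct x π χ y (monAct x π χ c (mon t))) +
              monAct x π χ ⁅y, x k⁆ (monAct x π χ c (mon t)) := by
        have hw := ih y (x k) (monAct_sub_mem x π χ d c ht)
        rcases hc with ⟨i, hi, hc⟩ | hc
        · rw [hc, mulVar_single] at hw
          have hu := H.monAct_var_comm (j := k) (t := i ::ₘ t) (fun j hj => by
            rcases Multiset.mem_cons.1 hj with rfl | hj
            exacts [hi, h j hj]) y
          simp only [map_sub] at hw
          rw [hu] at hw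
          rw [← sub_eq_zero] at hw ⊢
          rw [← hw]
          abel
        · rwa [hc, map_zero, LinearMap.zero_apply, sub_zero] at hw
      rcases H.gen_cases k ha with ⟨i, hi, rfl⟩ | ha
      · exact left (hmin hi)
      rcases H.gen_cases k hb with ⟨i, hi, rfl⟩ | hb
      · exact H.monAct_var_comm (hmin hi) _
      -- With the monomial written as `xₖ · t`, both sides are expanded until `xₖ` is leftmost or
      -- inside a bracket; the rest is the Jacobi identity `lie_lie`.
      rw [← H.monAct_var h, H.monAct_var_comm h a, H.monAct_var_comm h b, map_add, map_add,
        hcomm hb a, hcomm ha b, ih a b ht, ih a ⁅b, x k⁆ ht, ih b ⁅a, x k⁆ ht,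
        H.monAct_var_comm h ⁅a, b⁆, lie_lie a b (x k), map_add, map_sub, LinearMap.sub_apply]
      abel

theorem IsInduced.monAct_lie (y z : g) (v : Monomials N) :
    monAct x π χ y (monAct x π χ z v) =
      monAct x π χ z (monAct x π χ y v) + monAct x π χ ⁅y, z⁆ v := by
  refine LinearMap.congr_fun (f := monAct x π χ y ∘ₗ monAct x π χ z)
    (g := monAct x π χ z ∘ₗ monAct x π χ y + monAct x π χ ⁅y, z⁆) ?_ v
  refine Finsupp.lhom_ext' fun s => LinearMap.ext_ring ?_
  exact H.monAct_lie_of_mem (s.card + 1) y z (mon_mem_degLT (Nat.lt_succ_self _))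

end Induced

/-! ### Ordered monomials form a basis of the cyclic module. -/

section Induced

attribute [local instance 100] LieRing.ofAssociativeRing

variable {N : Type} [LinearOrder N] {g : Type} [LieRing g] [LieAlgebra ℂ g]
  {x : N → g} {π : g →ₗ[ℂ] N →₀ ℂ} {χ : g →ₗ[ℂ] ℂ} {S : Set (g × ℂ)} (H : IsInduced x π χ S)

/-- The action of `g` on monomials as a representation. -/
def IsInduced.rep : g →ₗ⁅ℂ⁆ Module.End ℂ (Monomials N) :=
  { monAct x π χ with
    map_lie' := fun {y z} => LinearMap.ext fun v => by
      change monAct x π χ ⁅y, z⁆ v = monAct x π χ y (monAct x π χ z v) -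
        monAct x π χ z (monAct x π χ y v)
      rw [H.monAct_lie y z v, add_sub_cancel_left] }

theorem IsInduced.rep_apply (y : g) (v : Monomials N) : H.rep y v = monAct x π χ y v := rfl

variable (x) in
/-- The ordered product of the variables of a monomial in the enveloping algebra. -/
def envMon (s : Multiset N) : UniversalEnvelopingAlgebra ℂ g :=
  ((s.sort (· ≤ ·)).map fun i => UniversalEnvelopingAlgebra.ι ℂ (x i)).prod

theorem envMon_zero : envMon x 0 = 1 := by simp [envMon]

theorem envMon_cons {j : N} {t : Multiset N} (h : ∀ i ∈ t, j ≤ i) :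
    envMon x (j ::ₘ t) = UniversalEnvelopingAlgebra.ι ℂ (x j) * envMon x t := by
  rw [envMon, Multiset.sort_cons _ _ _ h, List.map_cons, List.prod_cons, envMon]

variable (x) in
/-- The linear extension of `envMon`. -/
def envLift : Monomials N →ₗ[ℂ] UniversalEnvelopingAlgebra ℂ g :=
  Finsupp.linearCombination ℂ (envMon x)

theorem envLift_mon (s : Multiset N) : envLift x (mon s) = envMon x s := by
  simp [envLift]

/-- An ordered product applied to the monomial `1` places its variables in front one by one,
smallest last, so no correction ever arises. Together with `lift_eq_zero` this gives independence.
-/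
theorem IsInduced.lift_envLift (v : Monomials N) :
    UniversalEnvelopingAlgebra.lift ℂ H.rep (envLift x v) (mon 0) = v := by
  suffices h : (UniversalEnvelopingAlgebra.lift ℂ H.rep).toLinearMap.flip (mon 0) ∘ₗ envLift x =
      LinearMap.id from LinearMap.congr_fun h v
  refine Finsupp.lhom_ext' fun s => LinearMap.ext_ring ?_
  change UniversalEnvelopingAlgebra.lift ℂ H.rep (envLift x (mon s)) (mon 0) = mon s
  rw [envLift_mon]
  induction hn : s.card generalizing s with
  | zero => rw [Multiset.card_eq_zero.1 hn, envMon_zero, map_one, Module.End.one_apply]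
  | succ n ih =>
    induction s using multiset_min_induction with
    | h0 => simp at hn
    | hcons j t h =>
      rw [envMon_cons h, map_mul, Module.End.mul_apply, ih t (by simpa using hn),
        UniversalEnvelopingAlgebra.lift_ι_apply, rep_apply, H.monAct_var h]

/-- The monomial `1` satisfies the defining relations, so evaluation at it descends to the quotient
by the left ideal. -/
theorem IsInduced.lift_eq_zero {u : UniversalEnvelopingAlgebra ℂ g}
    (hu : u ∈ Submodule.span (UniversalEnvelopingAlgebra ℂ g)
      ((fun p : g × ℂ => UniversalEnvelopingAlgebra.ι ℂ p.1 -
        algebraMap ℂ (UniversalEnvelopingAlgebra ℂ g) p.2) '' S)) :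
    UniversalEnvelopingAlgebra.lift ℂ H.rep u (mon 0) = 0 := by
  induction hu using Submodule.span_induction with
  | mem u hu =>
    obtain ⟨p, hp, rfl⟩ := hu
    rw [map_sub, AlgHom.commutes, UniversalEnvelopingAlgebra.lift_ι_apply, LinearMap.sub_apply,
      rep_apply, monAct_zero, H.coord_rel p hp, H.char_rel p hp, Module.algebraMap_end_apply]
    simp
  | zero => simp
  | add u w _ _ hu hw => rw [map_add, LinearMap.add_apply, hu, hw, add_zero]
  | smul a u _ hu => rw [smul_eq_mul, map_mul, Module.End.mul_apply, hu, map_zero]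

/-- The map from monomials to the induced module. -/
def monToCyclic (x : N → g) (S : Set (g × ℂ)) : Monomials N →ₗ[ℂ] CyclicModule S :=
  (Submodule.mkQ _).restrictScalars ℂ ∘ₗ envLift x

theorem monToCyclic_mon (s : Multiset N) :
    monToCyclic x S (mon s) = envMon x s • CyclicModule.gen S := by
  rw [CyclicModule.gen, ← Submodule.Quotient.mk_smul, smul_eq_mul, mul_one, ← envLift_mon]
  rfl

theorem monToCyclic_cons {j : N} {t : Multiset N} (h : ∀ i ∈ t, j ≤ i) :
    monToCyclic x S (mon (j ::ₘ t)) =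
      UniversalEnvelopingAlgebra.ι ℂ (x j) • monToCyclic x S (mon t) := by
  rw [monToCyclic_mon, monToCyclic_mon, envMon_cons h, mul_smul]

theorem gen_rel {p : g × ℂ} (hp : p ∈ S) :
    UniversalEnvelopingAlgebra.ι ℂ p.1 • CyclicModule.gen S = p.2 • CyclicModule.gen S := by
  rw [← algebraMap_smul (UniversalEnvelopingAlgebra ℂ g) p.2 (CyclicModule.gen S), ← sub_eq_zero,
    ← sub_smul, CyclicModule.gen, ← Submodule.Quotient.mk_smul, Submodule.Quotient.mk_eq_zero,
    smul_eq_mul, mul_one]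
  exact Submodule.subset_span ⟨p, hp, rfl⟩

theorem ι_smul_comm {M : Type} [AddCommGroup M] [Module (UniversalEnvelopingAlgebra ℂ g) M]
    (z y : g) (v : M) :
    UniversalEnvelopingAlgebra.ι ℂ z • UniversalEnvelopingAlgebra.ι ℂ y • v =
      UniversalEnvelopingAlgebra.ι ℂ y • UniversalEnvelopingAlgebra.ι ℂ z • v +
        UniversalEnvelopingAlgebra.ι ℂ ⁅z, y⁆ • v := by
  rw [LieHom.map_lie, LieRing.of_associative_ring_bracket, sub_smul, mul_smul, mul_smul]
  abel

include H in
theorem IsInduced.monToCyclic_injective : Function.Injective (monToCyclic x S) := by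
  rw [injective_iff_map_eq_zero]
  intro v hv
  rw [← H.lift_envLift v]
  exact H.lift_eq_zero ((Submodule.Quotient.mk_eq_zero _).1 hv)

include H in
-- Equivariance holds because the cyclic module obeys the same commutation rules and relations that
-- determine the action on monomials.
theorem IsInduced.monToCyclic_monAct (d : ℕ) (y : g) {v : Monomials N} (hv : v ∈ degLT N d) :
    monToCyclic x S (monAct x π χ y v) =
      UniversalEnvelopingAlgebra.ι ℂ y • monToCyclic x S v := by
  induction d generalizing y v with
  | zero =>
    exact degLT_induction (f := monToCyclic x S ∘ₗ monAct x π χ y)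
      (f' := act g (CyclicModule S) y ∘ₗ monToCyclic x S) (fun s hs => absurd hs (by omega)) hv
  | succ d ih =>
    refine degLT_induction (f := monToCyclic x S ∘ₗ monAct x π χ y)
      (f' := act g (CyclicModule S) y ∘ₗ monToCyclic x S) (fun s hs => ?_) hv
    refine H.eq_of_gen (f := monToCyclic x S ∘ₗ (monAct x π χ).flip (mon s))
      (f' := ((Algebra.lsmul ℂ ℂ (CyclicModule S)).toLinearMap ∘ₗ
        (UniversalEnvelopingAlgebra.ι ℂ (L := g)).toLinearMap).flip
          (monToCyclic x S (mon s))) (fun a ha => ?_) y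
    change monToCyclic x S (monAct x π χ a (mon s)) =
      UniversalEnvelopingAlgebra.ι ℂ a • monToCyclic x S (mon s)
    have left {i : N} (hi : ∀ j ∈ s, i ≤ j) : monToCyclic x S (monAct x π χ (x i) (mon s)) =
        UniversalEnvelopingAlgebra.ι ℂ (x i) • monToCyclic x S (mon s) := by
      rw [H.monAct_var hi, monToCyclic_cons hi]
    induction s using multiset_min_induction with
    | h0 =>
      rcases ha with ⟨i, rfl⟩ | ⟨p, hp, rfl⟩
      · exact left (by simp)
      rw [monAct_zero, H.coord_rel p hp, map_zero, LinearMap.zero_apply, zero_add, map_smul,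
        monToCyclic_mon, envMon_zero, one_smul, gen_rel hp, H.char_rel p hp]
    | hcons k t h =>
      rw [Multiset.card_cons] at hs
      have hmin {i : N} (hi : i ≤ k) : ∀ j ∈ k ::ₘ t, i ≤ j := fun j hj => by
        rcases Multiset.mem_cons.1 hj with rfl | hj
        exacts [hi, hi.trans (h j hj)]
      have ht : mon t ∈ degLT N d := mon_mem_degLT (by omega)
      rcases H.gen_cases k ha with ⟨i, hi, rfl⟩ | ha
      · exact left (hmin hi)
      -- As in `monAct_lie_of_mem`, the leading monomial of `a · t` is treated directly and the
      -- remainder by induction.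
      have hk : monToCyclic x S (monAct x π χ (x k) (monAct x π χ a (mon t))) =
          UniversalEnvelopingAlgebra.ι ℂ (x k) • monToCyclic x S (monAct x π χ a (mon t)) := by
        have hw := ih (x k) (monAct_sub_mem x π χ d a ht)
        rcases ha with ⟨i, hi, ha⟩ | ha
        · have hki : ∀ j ∈ i ::ₘ t, k ≤ j := fun j hj => by
            rcases Multiset.mem_cons.1 hj with rfl | hj
            exacts [hi, h j hj]
          rwa [ha, mulVar_single, map_sub, map_sub, map_sub, smul_sub, H.monAct_var hki,
            monToCyclic_cons hki, sub_left_inj] at hw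
        · rwa [ha, map_zero, LinearMap.zero_apply, sub_zero] at hw
      rw [monToCyclic_cons h, ι_smul_comm, ← H.monAct_var h, H.monAct_var_comm h, map_add, hk,
        ih a ht, ih ⁅a, x k⁆ ht]

include H in
-- By equivariance the range is stable under the enveloping algebra, and it contains the generator.
theorem IsInduced.monToCyclic_surjective : Function.Surjective (monToCyclic x S) := by
  have h (u : UniversalEnvelopingAlgebra ℂ g) : ∀ w ∈ LinearMap.range (monToCyclic x S),
      u • w ∈ LinearMap.range (monToCyclic x S) := by
    induction u using universalEnveloping_induction with
    | halg a =>
      intro w hw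
      rw [algebraMap_smul]
      exact Submodule.smul_mem _ _ hw
    | hι y =>
      rintro _ ⟨v, rfl⟩
      induction v using Finsupp.induction_linear with
      | zero => simp
      | add v w hv hw => rw [map_add, smul_add]; exact add_mem hv hw
      | single s r =>
        rw [← mul_one r, ← smul_eq_mul, ← Finsupp.smul_single, map_smul, smul_comm]
        refine Submodule.smul_mem _ _ ⟨_, H.monToCyclic_monAct (s.card + 1) y
          (mon_mem_degLT (Nat.lt_succ_self _))⟩
    | hadd u u' hu hu' => intro w hw; rw [add_smul]; exact add_mem (hu w hw) (hu' w hw)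
    | hmul u u' hu hu' => intro w hw; rw [mul_smul]; exact hu _ (hu' w hw)
  intro w
  obtain ⟨u, rfl⟩ := Submodule.Quotient.mk_surjective _ w
  have := h u (CyclicModule.gen S) ⟨mon 0, by rw [monToCyclic_mon, envMon_zero, one_smul]⟩
  rwa [CyclicModule.gen, ← Submodule.Quotient.mk_smul, smul_eq_mul, mul_one] at this

/-- The basis of ordered monomials of an induced module. -/
def IsInduced.basis : Module.Basis (Multiset N) ℂ (CyclicModule S) :=
  Module.Basis.ofRepr (LinearEquiv.ofBijective (monToCyclic x S)
    ⟨H.monToCyclic_injective, H.monToCyclic_surjective⟩).symm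

theorem IsInduced.basis_apply (s : Multiset N) : H.basis s = envMon x s • CyclicModule.gen S := by
  rw [← monToCyclic_mon]
  rfl

end Induced

/-! ### Exponents and multisets -/

/-- The variable with index `3 i + r` is the `i`-th term of the `r`-th sequence, and `⊤` is the last
factor. -/
def interleave {A : Type} (X Y Z : ℕ → A) (W : A) : WithTop ℕ → A :=
  WithTop.recTopCoe W fun j =>
    if j % 3 = 0 then X (j / 3) else if j % 3 = 1 then Y (j / 3) else Z (j / 3)

section Interleave

variable {A : Type} (X Y Z : ℕ → A) (W : A)

@[simp] theorem interleave_top : interleave X Y Z W ⊤ = W := rfl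

theorem interleave_coe (j : ℕ) : interleave X Y Z W (WithTop.some j) =
    if j % 3 = 0 then X (j / 3) else if j % 3 = 1 then Y (j / 3) else Z (j / 3) := rfl

@[simp] theorem interleave_zero (i : ℕ) : interleave X Y Z W (WithTop.some (3 * i)) = X i := by
  rw [interleave_coe, if_pos (by omega)]
  congr 1; omega

@[simp] theorem interleave_one (i : ℕ) :
    interleave X Y Z W (WithTop.some (3 * i + 1)) = Y i := by
  rw [interleave_coe, if_neg (by omega), if_pos (by omega)]
  congr 1; omega

@[simp] theorem interleave_two (i : ℕ) :
    interleave X Y Z W (WithTop.some (3 * i + 2)) = Z i := by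
  rw [interleave_coe, if_neg (by omega), if_neg (by omega)]
  congr 1; omega

theorem withTop_cases {P : WithTop ℕ → Prop} (htop : P ⊤) (h0 : ∀ i : ℕ, P (WithTop.some (3 * i)))
    (h1 : ∀ i : ℕ, P (WithTop.some (3 * i + 1))) (h2 : ∀ i : ℕ, P (WithTop.some (3 * i + 2))) (a : WithTop ℕ) :
    P a := by
  induction a with
  | top => exact htop
  | coe j =>
    have h : j = 3 * (j / 3) ∨ j = 3 * (j / 3) + 1 ∨ j = 3 * (j / 3) + 2 := by omega
    rcases h with h | h | h <;> rw [h]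
    exacts [h0 _, h1 _, h2 _]

end Interleave

/-- The indices of the factors of a monomial that come from index `i` of the three sequences. -/
def Exponents.block (p : Exponents) (i : ℕ) : List (WithTop ℕ) :=
  List.replicate (p.k i) (WithTop.some (3 * i)) ++
    List.replicate (p.l i) (WithTop.some (3 * i + 1)) ++
      List.replicate (p.m i) (WithTop.some (3 * i + 2))

/-- The indices of the factors of a monomial in their order. -/
def Exponents.toList (p : Exponents) : List (WithTop ℕ) :=
  (List.range p.bound).flatMap p.block ++ List.replicate p.n ⊤

theorem Exponents.mem_block {p : Exponents} {i : ℕ} {a : WithTop ℕ} (h : a ∈ p.block i) :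
    ∃ r < 3, a = (WithTop.some (3 * i + r)) := by
  simp only [block, List.mem_append, List.mem_replicate] at h
  rcases h with (h | h) | h
  exacts [⟨0, by omega, h.2⟩, ⟨1, by omega, h.2⟩, ⟨2, by omega, h.2⟩]

theorem Exponents.pairwise_toList (p : Exponents) : p.toList.Pairwise (· ≤ ·) := by
  rw [toList, List.pairwise_append, List.pairwise_flatMap]
  refine ⟨⟨fun i _ => ?_, ?_⟩, ?_, ?_⟩
  · simp only [block, List.pairwise_append, List.pairwise_replicate, List.mem_append,
      List.mem_replicate]
    refine ⟨⟨by simp, by simp, ?_⟩, by simp, ?_⟩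
    · rintro a ⟨-, rfl⟩ b ⟨-, rfl⟩
      exact WithTop.coe_le_coe.2 (by omega)
    · rintro a (⟨-, rfl⟩ | ⟨-, rfl⟩) b ⟨-, rfl⟩
      · exact WithTop.coe_le_coe.2 (by omega)
      · exact WithTop.coe_le_coe.2 (by omega)
  · refine List.pairwise_lt_range.imp fun {i j} hij a ha b hb => ?_
    obtain ⟨r, hr, rfl⟩ := mem_block ha
    obtain ⟨s, hs, rfl⟩ := mem_block hb
    exact WithTop.coe_le_coe.2 (by omega)
  · simp
  · intro a _ b hb
    rw [List.eq_of_mem_replicate hb]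
    exact le_top

theorem Exponents.map_toList_prod {A : Type} [Ring A] (X Y Z : ℕ → A) (W : A) (p : Exponents) :
    (p.toList.map (interleave X Y Z W)).prod = orderedProduct X Y Z W p := by
  rw [toList, orderedProduct, List.map_append, List.prod_append, List.map_replicate,
    List.prod_replicate, interleave_top, List.map_flatMap, List.flatMap_def, List.prod_flatten, List.map_map]
  congr 3
  ext i
  simp only [Function.comp_apply, block, List.map_append, List.map_replicate, List.prod_append,
    List.prod_replicate, interleave_zero, interleave_one, interleave_two]

theorem Exponents.lt_bound {p : Exponents} {i : ℕ} (h : p.k i ≠ 0 ∨ p.l i ≠ 0 ∨ p.m i ≠ 0) :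
    i < p.bound := by
  refine Nat.lt_of_succ_le (Finset.le_sup (f := Nat.succ) ?_)
  simp only [Finset.mem_union, Finsupp.mem_support_iff]
  tauto

/-- Exponents are exactly multiplicities; this makes both composites in `equivMultiset` the
identity. -/
theorem Exponents.count_toList (p : Exponents) (a : WithTop ℕ) :
    p.toList.count a = interleave (A := ℕ) p.k p.l p.m p.n a := by
  -- Only block `i` contributes to the count, and it lies below the bound whenever its exponent is
  -- nonzero.
  have hsum (i : ℕ) (f : ℕ → ℕ) (e : ℕ) (hf : ∀ j, f j = if j = i then e else 0)
      (he : e ≠ 0 → i < p.bound) : ((List.range p.bound).map f).sum = e := by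
    change ∑ j ∈ Finset.range p.bound, f j = e
    rw [Finset.sum_congr rfl fun j _ => hf j, Finset.sum_ite_eq']
    split_ifs with h
    · rfl
    · by_contra h'
      exact h (Finset.mem_range.2 (he (Ne.symm h')))
  induction a using withTop_cases with
  | htop =>
    rw [toList, List.count_append, List.count_replicate_self, interleave_top, List.count_flatMap,
      hsum 0 _ 0 _ (by simp), zero_add]
    intro j
    simp only [Function.comp_apply, block, List.count_append, List.count_replicate, beq_iff_eq,
      WithTop.coe_ne_top, if_false, ite_self]
  | h0 i =>
    rw [toList, List.count_append, List.count_flatMap, interleave_zero,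
      hsum i _ (p.k i) _ fun h => lt_bound (Or.inl h)]
    · simp only [List.count_replicate, beq_iff_eq, WithTop.top_ne_coe, if_false, add_zero]
    · intro j
      simp only [Function.comp_apply, block, List.count_append, List.count_replicate, beq_iff_eq,
        WithTop.coe_inj]
      rw [if_neg (by omega : ¬ 3 * j + 1 = 3 * i), if_neg (by omega : ¬ 3 * j + 2 = 3 * i)]
      by_cases h : j = i <;> simp [h]
  | h1 i =>
    rw [toList, List.count_append, List.count_flatMap, interleave_one,
      hsum i _ (p.l i) _ fun h => lt_bound (Or.inr (Or.inl h))]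
    · simp only [List.count_replicate, beq_iff_eq, WithTop.top_ne_coe, if_false, add_zero]
    · intro j
      simp only [Function.comp_apply, block, List.count_append, List.count_replicate, beq_iff_eq,
        WithTop.coe_inj]
      rw [if_neg (by omega : ¬ 3 * j = 3 * i + 1), if_neg (by omega : ¬ 3 * j + 2 = 3 * i + 1)]
      by_cases h : j = i <;> simp [h]
  | h2 i =>
    rw [toList, List.count_append, List.count_flatMap, interleave_two,
      hsum i _ (p.m i) _ fun h => lt_bound (Or.inr (Or.inr h))]
    · simp only [List.count_replicate, beq_iff_eq, WithTop.top_ne_coe, if_false, add_zero]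
    · intro j
      simp only [Function.comp_apply, block, List.count_append, List.count_replicate, beq_iff_eq,
        WithTop.coe_inj]
      rw [if_neg (by omega : ¬ 3 * j = 3 * i + 2), if_neg (by omega : ¬ 3 * j + 1 = 3 * i + 2)]
      by_cases h : j = i <;> simp [h]

theorem some_injective (r : ℕ) : Function.Injective fun i : ℕ => WithTop.some (3 * i + r) :=
  fun i j h => by have := WithTop.coe_injective h; omega

/-- The exponents of a monomial given as a multiset of indices. -/
def Exponents.ofMultiset (s : Multiset (WithTop ℕ)) : Exponents where
  k := (Multiset.toFinsupp s).comapDomain (fun i : ℕ => WithTop.some (3 * i))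
    (some_injective 0).injOn
  l := (Multiset.toFinsupp s).comapDomain (fun i : ℕ => WithTop.some (3 * i + 1))
    (some_injective 1).injOn
  m := (Multiset.toFinsupp s).comapDomain (fun i : ℕ => WithTop.some (3 * i + 2))
    (some_injective 2).injOn
  n := s.count ⊤

/-- Exponents of monomials correspond to multisets of indices. -/
def Exponents.equivMultiset : Exponents ≃ Multiset (WithTop ℕ) where
  toFun p := p.toList
  invFun := ofMultiset
  left_inv p := by
    have h (a : WithTop ℕ) : Multiset.count a (p.toList : Multiset (WithTop ℕ)) =
        interleave (A := ℕ) p.k p.l p.m p.n a := by rw [Multiset.coe_count, count_toList]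
    obtain ⟨k, l, m, n⟩ := p
    simp only [ofMultiset, mk.injEq]
    refine ⟨?_, ?_, ?_, ?_⟩
    · ext i
      refine (h _).trans ?_
      rw [ interleave_zero]
    · ext i
      refine (h _).trans ?_
      rw [ interleave_one]
    · ext i
      refine (h _).trans ?_
      rw [ interleave_two]
    · rw [h, interleave_top]
  right_inv s := by
    ext a
    rw [Multiset.coe_count, count_toList]
    induction a using withTop_cases with
    | htop => rfl
    | h0 i => rw [interleave_zero]; simp [ofMultiset]
    | h1 i => rw [interleave_one]; simp [ofMultiset]
    | h2 i => rw [interleave_two]; simp [ofMultiset]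

/-- The order of factors prescribed in `orderedProduct` is the order of `WithTop ℕ`, so the abstract
ordered monomials are the ones of the theorem. -/
theorem Exponents.sort_equivMultiset (p : Exponents) :
    (equivMultiset p).sort (· ≤ ·) = p.toList := by
  refine List.Perm.eq_of_pairwise (le := (· ≤ ·)) (fun a b _ _ => le_antisymm)
    (Multiset.pairwise_sort _ _) p.pairwise_toList ?_
  rw [← Multiset.coe_eq_coe, Multiset.sort_eq]
  rfl

theorem envMon_equivMultiset {g : Type} [LieRing g] [LieAlgebra ℂ g] (X Y Z : ℕ → g) (W : g)
    (p : Exponents) :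
    envMon (interleave X Y Z W) (Exponents.equivMultiset p) =
      orderedProduct (fun i => UniversalEnvelopingAlgebra.ι ℂ (X i))
        (fun i => UniversalEnvelopingAlgebra.ι ℂ (Y i))
        (fun i => UniversalEnvelopingAlgebra.ι ℂ (Z i)) (UniversalEnvelopingAlgebra.ι ℂ W) p := by
  rw [envMon, Exponents.sort_equivMultiset, ← Exponents.map_toList_prod]
  congr 2
  ext a
  induction a using withTop_cases <;>
    simp only [interleave_top, interleave_zero, interleave_one, interleave_two]

/-! ### Finiteness of degrees -/

/-- The degree of a variable: the `i`-th variable has degree `i + 2`, the last one has degree `1`. -/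
def varDegree : WithTop ℕ → ℕ := WithTop.recTopCoe 1 fun j => j + 2

@[simp] theorem varDegree_top : varDegree ⊤ = 1 := rfl

@[simp] theorem varDegree_coe (j : ℕ) : varDegree (WithTop.some j) = j + 2 := rfl

theorem varDegree_pos (a : WithTop ℕ) : 0 < varDegree a := by
  cases a <;> simp only [varDegree_top, varDegree_coe] <;> omega

theorem varDegree_injective : Function.Injective varDegree := by
  intro a b h
  cases a <;> cases b <;> simp only [varDegree_top, varDegree_coe] at h
  · rfl
  · omega
  · omega
  · congr 1
    omega

/-- The degree of a monomial. -/
def Exponents.degree (p : Exponents) : ℕ := ((equivMultiset p).map varDegree).sum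

/-- Distinct variables have distinct positive degrees, so monomials of degree `d` inject into the
partitions of `d`. -/
theorem Exponents.finite_degree (d : ℕ) : {p : Exponents | p.degree = d}.Finite := by
  let f : {p : Exponents | p.degree = d} → Nat.Partition d := fun p =>
    { parts := (equivMultiset p.1).map varDegree
      parts_pos := fun {i} hi => by
        obtain ⟨a, -, rfl⟩ := Multiset.mem_map.1 hi
        exact varDegree_pos a
      parts_sum := p.2 }
  have hf : Function.Injective f := fun p q h =>
    Subtype.ext (equivMultiset.injective
      (Multiset.map_injective varDegree_injective (congrArg Nat.Partition.parts h)))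
  exact Finite.of_injective f hf

/-! ### The Virasoro Verma module -/

namespace Virasoro

/-- The coordinates of an element with respect to the `Lₛ` with `s < 0`. -/
def coord : Virasoro →ₗ[ℂ] WithTop ℕ →₀ ℂ :=
  Finsupp.lcomapDomain (fun a => -(varDegree a : ℤ))
    (fun a b h => varDegree_injective (by simpa using h)) ∘ₗ fst

/-- The character of the span of `C` and the `Lₛ` with `s ≥ 0`. -/
def char (c h : ℂ) : Virasoro →ₗ[ℂ] ℂ :=
  c • (show Virasoro →ₗ[ℂ] ℂ from LinearMap.snd ℂ (ℤ →₀ ℂ) ℂ) + h • (Finsupp.lapply 0 ∘ₗ fst)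

theorem coord_L (a : WithTop ℕ) : coord (L (-(varDegree a : ℤ))) = Finsupp.single a 1 := by
  ext b
  change Finsupp.single (-(varDegree a : ℤ)) (1 : ℂ) (-(varDegree b : ℤ)) = _
  rw [Finsupp.single_apply, Finsupp.single_apply]
  congr 1
  rw [neg_inj, Nat.cast_inj, varDegree_injective.eq_iff]

theorem coord_L_nonneg {s : ℤ} (hs : 0 ≤ s) : coord (L s) = 0 := by
  ext b
  have := varDegree_pos b
  exact Finsupp.single_eq_of_ne (a' := -(varDegree b : ℤ)) (by omega)

theorem coord_C : coord C = 0 := by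
  rw [coord, LinearMap.comp_apply, fst_C, map_zero]

theorem char_L (c h : ℂ) (s : ℤ) : char c h (L s) = if s = 0 then h else 0 := by
  change c * 0 + h * Finsupp.single s (1 : ℂ) 0 = _
  rw [Finsupp.single_apply]
  split_ifs <;> simp

theorem char_C (c h : ℂ) : char c h C = c := by
  change c * 1 + h * (0 : ℤ →₀ ℂ) 0 = _
  simp

theorem C_lie (x : Virasoro) : ⁅C, x⁆ = 0 := by
  rw [← lie_skew, lie_C, neg_zero]

theorem span_eq_top : Submodule.span ℂ (Set.range L ∪ {C}) = ⊤ := by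
  rw [eq_top_iff]
  rintro ⟨f, a⟩ -
  have h : ((f, a) : (ℤ →₀ ℂ) × ℂ) = (f, 0) + a • (0, 1) := by simp
  rw [h]
  refine add_mem (M := Virasoro) ?_
    (Submodule.smul_mem (M := Virasoro) _ a (Submodule.subset_span (Or.inr rfl)))
  induction f using Finsupp.induction_linear with
  | zero => exact zero_mem _
  | add f f' hf hf' =>
    rw [show ((f + f', 0) : (ℤ →₀ ℂ) × ℂ) = (f, 0) + (f', 0) by simp]
    exact add_mem (M := Virasoro) (hf (by simp)) (hf' (by simp))
  | single s r =>
    rw [show ((Finsupp.single s r, 0) : (ℤ →₀ ℂ) × ℂ) = r • (Finsupp.single s 1, 0) by simp]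
    exact Submodule.smul_mem (M := Virasoro) _ r (Submodule.subset_span (Or.inl ⟨s, rfl⟩))

end Virasoro

/-- The Virasoro elements `L₋₂, L₋₃, …, L₋₁` in this order. -/
def virasoroVar : WithTop ℕ → Virasoro :=
  interleave (fun i => Virasoro.L (-3 * (i + 1) + 1)) (fun i => Virasoro.L (-3 * (i + 1)))
    (fun i => Virasoro.L (-3 * (i + 1) - 1)) (Virasoro.L (-1))

theorem virasoroVar_eq (a : WithTop ℕ) : virasoroVar a = Virasoro.L (-(varDegree a : ℤ)) := by
  induction a using withTop_cases <;>
    simp only [virasoroVar, interleave_top, interleave_zero, interleave_one, interleave_two,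
      varDegree_top, varDegree_coe] <;> exact congrArg _ (by omega)

theorem virasoroRelations_cases {c h : ℂ} {p : Virasoro × ℂ} (hp : p ∈ virasoroRelations c h) :
    p = (Virasoro.C, c) ∨ ∃ n : ℕ, p = (Virasoro.L n, if n = 0 then h else 0) := by
  rcases hp with (rfl | rfl) | ⟨n, rfl⟩
  · exact Or.inl rfl
  · exact Or.inr ⟨0, by simp⟩
  · exact Or.inr ⟨n + 1, by simp⟩

theorem virasoro_isInduced (c h : ℂ) :
    IsInduced virasoroVar Virasoro.coord (Virasoro.char c h) (virasoroRelations c h) where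
  coord_var a := by rw [virasoroVar_eq, Virasoro.coord_L]
  coord_rel p hp := by
    rcases virasoroRelations_cases hp with rfl | ⟨n, rfl⟩
    exacts [Virasoro.coord_C, Virasoro.coord_L_nonneg (by omega)]
  char_rel p hp := by
    rcases virasoroRelations_cases hp with rfl | ⟨n, rfl⟩
    · exact Virasoro.char_C c h
    · simp [Virasoro.char_L]
  char_var a := by
    have := varDegree_pos a
    rw [virasoroVar_eq, Virasoro.char_L, if_neg (by omega)]
  coord_lie p hp q hq := by
    rcases virasoroRelations_cases hp with rfl | ⟨m, rfl⟩
    · rw [Virasoro.C_lie, map_zero]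
    rcases virasoroRelations_cases hq with rfl | ⟨n, rfl⟩
    · rw [Virasoro.lie_C, map_zero]
    rw [Virasoro.lie_L_L, map_add, map_smul, map_smul, Virasoro.coord_C,
      Virasoro.coord_L_nonneg (by omega), smul_zero, smul_zero, add_zero]
  char_lie p hp q hq := by
    rcases virasoroRelations_cases hp with rfl | ⟨m, rfl⟩
    · rw [Virasoro.C_lie, map_zero]
    rcases virasoroRelations_cases hq with rfl | ⟨n, rfl⟩
    · rw [Virasoro.lie_C, map_zero]
    rw [Virasoro.lie_L_L, map_add, map_smul, map_smul, Virasoro.char_L]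
    -- For nonnegative modes this forces `m = n = 0`, where both `m - n` and `m³ - m` vanish.
    by_cases hmn : (m : ℤ) + n = 0
    · obtain rfl : m = 0 := by omega
      obtain rfl : n = 0 := by omega
      simp
    · simp [hmn]
  span_eq_top := by
    rw [eq_top_iff, ← Virasoro.span_eq_top, Submodule.span_le]
    rintro _ (⟨s, rfl⟩ | rfl)
    · refine Submodule.subset_span ?_
      rcases lt_or_ge s 0 with hs | hs
      · have h (a : WithTop ℕ) (ha : s = -(varDegree a : ℤ)) :
            Virasoro.L s ∈ Set.range virasoroVar := ⟨a, by rw [virasoroVar_eq, ha]⟩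
        rcases eq_or_ne s (-1) with h1 | h1
        · exact Or.inl (h ⊤ (by simpa using h1))
        · exact Or.inl (h (WithTop.some (-s - 2).toNat) (by rw [varDegree_coe]; omega))
      · obtain ⟨n, rfl⟩ := Int.eq_ofNat_of_zero_le hs
        cases n with
        | zero => exact Or.inr ⟨_, Or.inl (Or.inr rfl), rfl⟩
        | succ n => exact Or.inr ⟨_, Or.inr ⟨n, rfl⟩, rfl⟩
    · exact Submodule.subset_span (Or.inr ⟨_, Or.inl (Or.inl rfl), rfl⟩)

/-- The basis of monomials of the Virasoro Verma module. -/
def virasoroBasis (c h : ℂ) : Module.Basis Exponents ℂ (VirasoroVerma c h) :=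
  (virasoro_isInduced c h).basis.reindex Exponents.equivMultiset.symm

theorem virasoroBasis_apply (c h : ℂ) (p : Exponents) :
    virasoroBasis c h p = virasoroMonomial c h p := by
  rw [virasoroBasis, Module.Basis.reindex_apply, Equiv.symm_symm, IsInduced.basis_apply,
    virasoroVar, envMon_equivMultiset]
  rfl

/-! ### The affine Verma modules -/

/-- A basis of `sl₂` with the relations of `e, h, f` for `sign = 1` and of `f, h, e` for
`sign = -1`, together with its coordinate functions. -/
structure Triple where
  E : Sl2
  H : Sl2
  F : Sl2
  sign : ℂ
  cE : Sl2 →ₗ[ℂ] ℂ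
  cH : Sl2 →ₗ[ℂ] ℂ
  cF : Sl2 →ₗ[ℂ] ℂ
  eq_sum : ∀ x, x = cE x • E + cH x • H + cF x • F
  cE_E : cE E = 1
  cE_H : cE H = 0
  cE_F : cE F = 0
  cH_E : cH E = 0
  cH_H : cH H = 1
  cH_F : cH F = 0
  cF_E : cF E = 0
  cF_H : cF H = 0
  cF_F : cF F = 1
  lie_HE : ⁅H, E⁆ = (2 * sign) • E
  lie_HF : ⁅H, F⁆ = (-2 * sign) • F
  sign_sq : sign * sign = 1

/-- The matrix entries as linear functions on `sl₂`. -/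
def sl2Entry (i j : Fin 2) : Sl2 →ₗ[ℂ] ℂ :=
  { toFun := fun x => x.1 i j
    map_add' := fun _ _ => rfl
    map_smul' := fun _ _ => rfl }

theorem sl2Entry_apply (i j : Fin 2) (x : Sl2) : sl2Entry i j x = x.1 i j := rfl

theorem sl2_eq_sum (x : Sl2) :
    x = sl2Entry 0 1 x • sl2E + sl2Entry 0 0 x • sl2H + sl2Entry 1 0 x • sl2F := by
  have h : Matrix.trace x.1 = 0 := LinearMap.mem_ker.1 x.2
  rw [Matrix.trace_fin_two] at h
  apply Subtype.ext
  ext i j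
  change x.1 i j = sl2Entry 0 1 x * sl2E.1 i j + sl2Entry 0 0 x * sl2H.1 i j +
    sl2Entry 1 0 x * sl2F.1 i j
  fin_cases i <;> fin_cases j <;> simp [sl2Entry_apply, sl2E, sl2H, sl2F]
  linear_combination h

theorem sl2_lie_HE : ⁅sl2H, sl2E⁆ = (2 : ℂ) • sl2E := by
  apply Subtype.ext
  rw [LieAlgebra.SpecialLinear.sl_bracket]
  ext i j
  fin_cases i <;> fin_cases j <;> (simp [sl2E, sl2H]; try norm_num)

theorem sl2_lie_HF : ⁅sl2H, sl2F⁆ = (-2 : ℂ) • sl2F := by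
  apply Subtype.ext
  rw [LieAlgebra.SpecialLinear.sl_bracket]
  ext i j
  fin_cases i <;> fin_cases j <;> (simp [sl2F, sl2H]; try norm_num)

theorem sl2_trace_EF : Matrix.trace (sl2E.1 * sl2F.1) = 1 := by
  simp [sl2E, sl2F, Matrix.trace_fin_two]

theorem sl2_trace_HH : Matrix.trace (sl2H.1 * sl2H.1) = 2 := by
  simp [sl2H, Matrix.trace_fin_two]
  norm_num

theorem sl2_trace_HE : Matrix.trace (sl2H.1 * sl2E.1) = 0 := by
  simp [sl2H, sl2E, Matrix.trace_fin_two]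

theorem sl2_trace_HF : Matrix.trace (sl2H.1 * sl2F.1) = 0 := by
  simp [sl2H, sl2F, Matrix.trace_fin_two]

theorem sl2_lie_EF : ⁅sl2E, sl2F⁆ = sl2H := by
  apply Subtype.ext
  rw [LieAlgebra.SpecialLinear.sl_bracket]
  ext i j
  fin_cases i <;> fin_cases j <;> simp [sl2E, sl2F, sl2H]

/-- The triple `e, h, f`. -/
def tripleEHF : Triple where
  E := sl2E
  H := sl2H
  F := sl2F
  sign := 1
  cE := sl2Entry 0 1
  cH := sl2Entry 0 0
  cF := sl2Entry 1 0
  eq_sum := sl2_eq_sum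
  cE_E := by simp [sl2Entry_apply, sl2E]
  cE_H := by simp [sl2Entry_apply, sl2H]
  cE_F := by simp [sl2Entry_apply, sl2F]
  cH_E := by simp [sl2Entry_apply, sl2E]
  cH_H := by simp [sl2Entry_apply, sl2H]
  cH_F := by simp [sl2Entry_apply, sl2F]
  cF_E := by simp [sl2Entry_apply, sl2E]
  cF_H := by simp [sl2Entry_apply, sl2H]
  cF_F := by simp [sl2Entry_apply, sl2F]
  lie_HE := by rw [sl2_lie_HE, mul_one]
  lie_HF := by rw [sl2_lie_HF, mul_one]
  sign_sq := one_mul 1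

/-- The triple `f, h, e`. -/
def tripleFHE : Triple where
  E := sl2F
  H := sl2H
  F := sl2E
  sign := -1
  cE := sl2Entry 1 0
  cH := sl2Entry 0 0
  cF := sl2Entry 0 1
  eq_sum x := by nth_rw 1 [sl2_eq_sum x]; abel
  cE_E := tripleEHF.cF_F
  cE_H := tripleEHF.cF_H
  cE_F := tripleEHF.cF_E
  cH_E := tripleEHF.cH_F
  cH_H := tripleEHF.cH_H
  cH_F := tripleEHF.cH_E
  cF_E := tripleEHF.cE_F
  cF_H := tripleEHF.cE_H
  cF_F := tripleEHF.cE_E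
  lie_HE := by rw [sl2_lie_HF]; norm_num
  lie_HF := by rw [sl2_lie_HE]; norm_num
  sign_sq := by norm_num

/-- The component of an element of the affine algebra in the loop algebra. -/
def affineLoop : AffineSl2 →ₗ[ℂ] ℤ →₀ Sl2 :=
  (LieAlgebra.LoopAlgebra.toFinsupp ℂ ℤ Sl2).toLinearMap ∘ₗ
    { toFun := fun y => ((LieAlgebra.ofProd affineCocycle).symm y).1
      map_add' := fun _ _ => rfl
      map_smul' := fun _ _ => rfl }

/-- The coefficient of the central element. -/
def affineCenter : AffineSl2 →ₗ[ℂ] ℂ :=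
  (TrivialLieModule.equiv ℂ LoopSl2 ℂ).toLinearMap ∘ₗ
    { toFun := fun y => ((LieAlgebra.ofProd affineCocycle).symm y).2
      map_add' := fun _ _ => rfl
      map_smul' := fun _ _ => rfl }

theorem affineLoop_mode (x : Sl2) (n : ℤ) : affineLoop (mode x n) = Finsupp.single n x :=
  LieAlgebra.LoopAlgebra.toFinsupp_single_tmul ℂ ℤ Sl2 n x

theorem affineLoop_centralK : affineLoop centralK = 0 :=
  map_zero (LieAlgebra.LoopAlgebra.toFinsupp ℂ ℤ Sl2)

theorem affineCenter_mode (x : Sl2) (n : ℤ) : affineCenter (mode x n) = 0 :=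
  map_zero (TrivialLieModule.equiv ℂ LoopSl2 ℂ)

theorem affineCenter_centralK : affineCenter centralK = 1 :=
  (TrivialLieModule.equiv ℂ LoopSl2 ℂ).apply_symm_apply 1

theorem centralK_lie (x : AffineSl2) : ⁅centralK, x⁆ = 0 := by
  rw [← lie_skew, lie_centralK, neg_zero]

theorem mode_add (x y : Sl2) (n : ℤ) : mode (x + y) n = mode x n + mode y n := by
  rw [mode, mode, mode, ← LieAlgebra.of_add, Prod.mk_add_mk, TensorProduct.tmul_add, add_zero]

theorem mode_smul (a : ℂ) (x : Sl2) (n : ℤ) : mode (a • x) n = a • mode x n := by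
  rw [mode, mode, ← LieAlgebra.of_smul, Prod.smul_mk, TensorProduct.tmul_smul, smul_zero]

namespace Triple

variable (t : Triple)

/-- The coordinates with respect to the modes of negative degree and `F₀`. -/
def coord : AffineSl2 →ₗ[ℂ] WithTop ℕ →₀ ℂ :=
  (Finsupp.lsum ℂ fun n : ℤ =>
    if n = 0 then Finsupp.lsingle ⊤ ∘ₗ t.cF
    else if n < 0 then Finsupp.lsingle (WithTop.some (3 * (-n - 1).toNat)) ∘ₗ t.cE +
      Finsupp.lsingle (WithTop.some (3 * (-n - 1).toNat + 1)) ∘ₗ t.cH +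
      Finsupp.lsingle (WithTop.some (3 * (-n - 1).toNat + 2)) ∘ₗ t.cF
    else 0) ∘ₗ affineLoop

/-- The character of the Borel subalgebra. -/
def char (k ν : ℂ) : AffineSl2 →ₗ[ℂ] ℂ :=
  k • affineCenter + ν • (t.cH ∘ₗ Finsupp.lapply 0 ∘ₗ affineLoop)

theorem coord_mode_zero (x : Sl2) : t.coord (mode x 0) = Finsupp.single ⊤ (t.cF x) := by
  simp [coord, affineLoop_mode]

theorem coord_mode_pos (x : Sl2) {n : ℤ} (hn : 0 < n) : t.coord (mode x n) = 0 := by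
  simp [coord, affineLoop_mode, hn.ne', hn.not_gt]

theorem coord_mode_neg (x : Sl2) (i : ℕ) : t.coord (mode x (-(i + 1))) =
    Finsupp.single (WithTop.some (3 * i)) (t.cE x) +
      Finsupp.single (WithTop.some (3 * i + 1)) (t.cH x) +
      Finsupp.single (WithTop.some (3 * i + 2)) (t.cF x) := by
  have h : (-(-((i : ℤ) + 1)) - 1).toNat = i := by omega
  rw [coord, LinearMap.comp_apply, affineLoop_mode, Finsupp.lsum_single, if_neg (by omega),
    if_pos (by omega), h]
  rfl

theorem coord_centralK : t.coord centralK = 0 := by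
  rw [coord, LinearMap.comp_apply, affineLoop_centralK, map_zero]

theorem char_mode (k ν : ℂ) (x : Sl2) (n : ℤ) :
    t.char k ν (mode x n) = if n = 0 then ν * t.cH x else 0 := by
  simp only [char, LinearMap.add_apply, LinearMap.smul_apply, LinearMap.comp_apply,
    affineCenter_mode, affineLoop_mode, Finsupp.lapply_apply, Finsupp.single_apply]
  split_ifs <;> simp

theorem char_centralK (k ν : ℂ) : t.char k ν centralK = k := by
  simp [char, affineCenter_centralK, affineLoop_centralK]

/-- The relations of the generator of the Verma module attached to a triple. -/
def relations (k ν : ℂ) : Set (AffineSl2 × ℂ) :=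
  {(centralK, k), (mode t.H 0, ν), (mode t.E 0, 0)} ∪
    {p | ∃ (x : Sl2) (n : ℕ), p = (mode x (n + 1), 0)}

/-- The variables `E₋₁, H₋₁, F₋₁, E₋₂, …, F₀` in this order. -/
def var : WithTop ℕ → AffineSl2 :=
  interleave (fun i => mode t.E (-(i + 1))) (fun i => mode t.H (-(i + 1)))
    (fun i => mode t.F (-(i + 1))) (mode t.F 0)

theorem relations_cases {k ν : ℂ} {p : AffineSl2 × ℂ} (hp : p ∈ t.relations k ν) :
    p = (centralK, k) ∨ ∃ (x : Sl2) (n : ℕ), p = (mode x n, if n = 0 then ν * t.cH x else 0) ∧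
      (n = 0 → x = t.H ∨ x = t.E) := by
  rcases hp with (rfl | rfl | rfl) | ⟨x, n, rfl⟩
  · exact Or.inl rfl
  · exact Or.inr ⟨t.H, 0, by simp [t.cH_H], fun _ => Or.inl rfl⟩
  · exact Or.inr ⟨t.E, 0, by simp [t.cH_E], fun _ => Or.inr rfl⟩
  · exact Or.inr ⟨x, n + 1, by simp, fun h => by omega⟩

theorem borel_lie {x y : Sl2} (hx : x = t.H ∨ x = t.E) (hy : y = t.H ∨ y = t.E) :
    t.cF ⁅x, y⁆ = 0 ∧ t.cH ⁅x, y⁆ = 0 := by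
  rcases hx with rfl | rfl <;> rcases hy with rfl | rfl
  · simp
  · rw [t.lie_HE]; simp [t.cF_E, t.cH_E]
  · rw [← lie_skew, t.lie_HE]; simp [t.cF_E, t.cH_E]
  · simp

/-- Brackets of relations stay in nonnegative degree. Degree zero is reached only from two zero
modes, where `borel_lie` applies and the cocycle vanishes. -/
theorem isInduced (k ν : ℂ) : IsInduced t.var t.coord (t.char k ν) (t.relations k ν) where
  coord_var a := by
    induction a using withTop_cases with
    | htop => rw [var, interleave_top, coord_mode_zero, t.cF_F]
    | h0 i =>
      rw [var, interleave_zero, coord_mode_neg, t.cE_E, t.cH_E, t.cF_E]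
      simp only [Finsupp.single_zero, add_zero]
    | h1 i =>
      rw [var, interleave_one, coord_mode_neg, t.cE_H, t.cH_H, t.cF_H]
      simp only [Finsupp.single_zero, add_zero, zero_add]
    | h2 i =>
      rw [var, interleave_two, coord_mode_neg, t.cE_F, t.cH_F, t.cF_F]
      simp only [Finsupp.single_zero, zero_add]
  coord_rel p hp := by
    rcases t.relations_cases hp with rfl | ⟨x, n, rfl, hn⟩
    · exact t.coord_centralK
    rcases n.eq_zero_or_pos with rfl | hn'
    · change t.coord (mode x 0) = 0
      rw [coord_mode_zero]
      rcases hn rfl with rfl | rfl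
      · rw [t.cF_H, Finsupp.single_zero]
      · rw [t.cF_E, Finsupp.single_zero]
    · exact t.coord_mode_pos x (by omega)
  char_rel p hp := by
    rcases t.relations_cases hp with rfl | ⟨x, n, rfl, hn⟩
    · exact t.char_centralK k ν
    · simp [char_mode]
  char_var a := by
    induction a using withTop_cases with
    | htop => rw [var, interleave_top, char_mode, t.cH_F, mul_zero, ite_self]
    | h0 i => rw [var, interleave_zero, char_mode, if_neg (by omega)]
    | h1 i => rw [var, interleave_one, char_mode, if_neg (by omega)]
    | h2 i => rw [var, interleave_two, char_mode, if_neg (by omega)]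
  coord_lie p hp q hq := by
    rcases t.relations_cases hp with rfl | ⟨x, m, rfl, hm⟩
    · rw [centralK_lie, map_zero]
    rcases t.relations_cases hq with rfl | ⟨y, n, rfl, hn⟩
    · rw [lie_centralK, map_zero]
    rw [lie_mode_mode, map_add, map_smul, coord_centralK, smul_zero, add_zero]
    by_cases hmn : (m : ℤ) + n = 0
    · rw [hmn, coord_mode_zero, (t.borel_lie (hm (by omega)) (hn (by omega))).1,
        Finsupp.single_zero]
    · exact t.coord_mode_pos _ (by omega)
  char_lie p hp q hq := by
    rcases t.relations_cases hp with rfl | ⟨x, m, rfl, hm⟩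
    · rw [centralK_lie, map_zero]
    rcases t.relations_cases hq with rfl | ⟨y, n, rfl, hn⟩
    · rw [lie_centralK, map_zero]
    rw [lie_mode_mode, map_add, map_smul, char_mode]
    by_cases hmn : (m : ℤ) + n = 0
    · obtain rfl : m = 0 := by omega
      obtain rfl : n = 0 := by omega
      simp [(t.borel_lie (hm rfl) (hn rfl)).2]
    · simp [hmn]
  span_eq_top := by
    have hrel {y : AffineSl2} (a : ℂ) (h : (y, a) ∈ t.relations k ν) :
        y ∈ Submodule.span ℂ (Set.range t.var ∪ Prod.fst '' t.relations k ν) :=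
      Submodule.subset_span (Or.inr ⟨_, h, rfl⟩)
    have hvar (a : WithTop ℕ) {y : AffineSl2} (h : t.var a = y) :
        y ∈ Submodule.span ℂ (Set.range t.var ∪ Prod.fst '' t.relations k ν) :=
      Submodule.subset_span (Or.inl ⟨a, h⟩)
    rw [eq_top_iff]
    intro y _
    induction y using affine_induction with
    | hK => exact hrel k (Or.inl (Or.inl rfl))
    | hadd y z hy hz => exact add_mem (hy trivial) (hz trivial)
    | hsmul a y hy => exact Submodule.smul_mem _ a (hy trivial)
    | hmode x n =>
      rcases lt_trichotomy n 0 with hn | rfl | hn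
      · obtain ⟨i, rfl⟩ : ∃ i : ℕ, n = -(i + 1) := ⟨(-n - 1).toNat, by omega⟩
        rw [t.eq_sum x, mode_add, mode_add, mode_smul, mode_smul, mode_smul]
        exact add_mem (add_mem
          (Submodule.smul_mem _ _ (hvar (WithTop.some (3 * i)) (by rw [var, interleave_zero])))
          (Submodule.smul_mem _ _ (hvar (WithTop.some (3 * i + 1)) (by rw [var, interleave_one]))))
          (Submodule.smul_mem _ _ (hvar (WithTop.some (3 * i + 2)) (by rw [var, interleave_two])))
      · rw [t.eq_sum x, mode_add, mode_add, mode_smul, mode_smul, mode_smul]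
        exact add_mem (add_mem
          (Submodule.smul_mem _ _ (hrel 0 (Or.inl (Or.inr (Or.inr rfl)))))
          (Submodule.smul_mem _ _ (hrel ν (Or.inl (Or.inr (Or.inl rfl))))))
          (Submodule.smul_mem _ _ (hvar ⊤ rfl))
      · obtain ⟨i, rfl⟩ : ∃ i : ℕ, n = i + 1 := ⟨(n - 1).toNat, by omega⟩
        exact hrel 0 (Or.inr ⟨x, i, rfl⟩)

/-- The basis of monomials of the Verma module attached to a triple. -/
def basis (k ν : ℂ) : Module.Basis Exponents ℂ (CyclicModule (t.relations k ν)) :=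
  (t.isInduced k ν).basis.reindex Exponents.equivMultiset.symm

theorem basis_apply (k ν : ℂ) (p : Exponents) :
    t.basis k ν p = orderedProduct (fun i => affineU t.E (-(i + 1)))
      (fun i => affineU t.H (-(i + 1))) (fun i => affineU t.F (-(i + 1))) (affineU t.F 0) p •
        CyclicModule.gen (t.relations k ν) := by
  rw [basis, Module.Basis.reindex_apply, Equiv.symm_symm, IsInduced.basis_apply, var,
    envMon_equivMultiset]
  rfl

end Triple

/-! ### Commutation relations of the Sugawara operator -/

section Sugawara

variable {k : ℂ} {M : Type} [AddCommGroup M] [Module ℂ M]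
  [Module (UniversalEnvelopingAlgebra ℂ AffineSl2) M]
  [IsScalarTower ℂ (UniversalEnvelopingAlgebra ℂ AffineSl2) M]

theorem act_act {g : Type} [LieRing g] [LieAlgebra ℂ g] {M : Type} [AddCommGroup M] [Module ℂ M]
    [Module (UniversalEnvelopingAlgebra ℂ g) M] [IsScalarTower ℂ (UniversalEnvelopingAlgebra ℂ g) M]
    (y z : g) (v : M) : act g M y (act g M z v) = act g M z (act g M y v) + act g M ⁅y, z⁆ v :=
  ι_smul_comm y z v

theorem act_add {g : Type} [LieRing g] [LieAlgebra ℂ g] {M : Type} [AddCommGroup M] [Module ℂ M]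
    [Module (UniversalEnvelopingAlgebra ℂ g) M] [IsScalarTower ℂ (UniversalEnvelopingAlgebra ℂ g) M]
    (y z : g) (v : M) : act g M (y + z) v = act g M y v + act g M z v := by
  simp only [act, map_add, LinearMap.add_apply]

theorem act_smul {g : Type} [LieRing g] [LieAlgebra ℂ g] {M : Type} [AddCommGroup M] [Module ℂ M]
    [Module (UniversalEnvelopingAlgebra ℂ g) M] [IsScalarTower ℂ (UniversalEnvelopingAlgebra ℂ g) M]
    (a : ℂ) (z : g) (v : M) : act g M (a • z) v = a • act g M z v := by
  simp only [act, map_smul, LinearMap.smul_apply]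

/-- The action of the mode `xₙ`. -/
abbrev md (M : Type) [AddCommGroup M] [Module ℂ M]
    [Module (UniversalEnvelopingAlgebra ℂ AffineSl2) M]
    [IsScalarTower ℂ (UniversalEnvelopingAlgebra ℂ AffineSl2) M] (x : Sl2) (n : ℤ) :
    Module.End ℂ M := act AffineSl2 M (mode x n)

theorem md_add (x y : Sl2) (n : ℤ) (v : M) : md M (x + y) n v = md M x n v + md M y n v := by
  rw [md, mode_add, act_add]

theorem md_smul (a : ℂ) (x : Sl2) (n : ℤ) (v : M) : md M (a • x) n v = a • md M x n v := by
  rw [md, mode_smul, act_smul]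

variable (hK : ∀ v : M, act AffineSl2 M centralK v = k • v)

include hK in
theorem md_md (x y : Sl2) (m n : ℤ) (v : M) :
    md M x m (md M y n v) = md M y n (md M x m v) + md M ⁅x, y⁆ (m + n) v +
      (if m + n = 0 then (m : ℂ) * Matrix.trace (x.1 * y.1) else 0) • k • v := by
  rw [md, md, act_act, lie_mode_mode, act_add, act_smul, hK, add_assoc]

include hK in
theorem md_E_H (m n : ℤ) (v : M) : md M sl2E m (md M sl2H n v) =
    md M sl2H n (md M sl2E m v) - (2 : ℂ) • md M sl2E (m + n) v := by
  rw [md_md hK, ← lie_skew, sl2_lie_HE, Matrix.trace_mul_comm, sl2_trace_HE, ← neg_smul,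
    md_smul]
  simp only [mul_zero, ite_self]
  module

include hK in
theorem md_F_H (m n : ℤ) (v : M) : md M sl2F m (md M sl2H n v) =
    md M sl2H n (md M sl2F m v) + (2 : ℂ) • md M sl2F (m + n) v := by
  rw [md_md hK, ← lie_skew, sl2_lie_HF, Matrix.trace_mul_comm, sl2_trace_HF, ← neg_smul,
    md_smul]
  simp only [mul_zero, ite_self]
  module

include hK in
theorem md_H_H (m n : ℤ) (v : M) : md M sl2H m (md M sl2H n v) =
    md M sl2H n (md M sl2H m v) + (if m + n = 0 then 2 * (m : ℂ) * k else 0) • v := by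
  rw [md_md hK, lie_self, sl2_trace_HH, ← zero_smul ℂ (0 : Sl2), md_smul]
  split_ifs <;> module

include hK in
theorem md_H_E (m n : ℤ) (v : M) : md M sl2H m (md M sl2E n v) =
    md M sl2E n (md M sl2H m v) + (2 : ℂ) • md M sl2E (m + n) v := by
  rw [md_E_H hK, add_comm n m, sub_add_cancel]

include hK in
theorem md_H_F (m n : ℤ) (v : M) : md M sl2H m (md M sl2F n v) =
    md M sl2F n (md M sl2H m v) - (2 : ℂ) • md M sl2F (m + n) v := by
  rw [md_F_H hK, add_comm n m, add_sub_cancel_right]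

include hK in
theorem md_E_F (m n : ℤ) (v : M) : md M sl2E m (md M sl2F n v) =
    md M sl2F n (md M sl2E m v) + md M sl2H (m + n) v +
      (if m + n = 0 then (m : ℂ) * k else 0) • v := by
  rw [md_md hK, sl2_lie_EF, sl2_trace_EF]
  split_ifs <;> module

theorem sugawaraTerm_apply (n : ℕ) (v : M) : sugawaraTerm M n v =
    md M sl2E (-n) (md M sl2F n v) + md M sl2F (-n) (md M sl2E n v) +
      (1 / 2 : ℂ) • md M sl2H (-n) (md M sl2H n v) := rfl

include hK in
-- Each term pairs dual bases of `sl₂` for the trace form, so it is invariant under zero modes; the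
-- central terms carry the mode number `0` as a factor.
theorem sugawaraTerm_md_E_zero (n : ℕ) (v : M) :
    sugawaraTerm M n (md M sl2E 0 v) = md M sl2E 0 (sugawaraTerm M n v) := by
  have hE (m : ℤ) (v : M) : md M sl2E m (md M sl2E 0 v) = md M sl2E 0 (md M sl2E m v) := by
    rw [md_md hK, lie_self, ← zero_smul ℂ (0 : Sl2), md_smul]
    split_ifs with h <;> simp_all
  have hF (m : ℤ) (v : M) : md M sl2F m (md M sl2E 0 v) =
      md M sl2E 0 (md M sl2F m v) - md M sl2H m v := by
    rw [md_E_F hK, zero_add]; simp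
  have hH (m : ℤ) (v : M) : md M sl2H m (md M sl2E 0 v) =
      md M sl2E 0 (md M sl2H m v) + (2 : ℂ) • md M sl2E m v := by
    rw [md_H_E hK, add_zero]
  have hc := md_H_E hK (-n) n v
  simp only [sugawaraTerm_apply, hE, hF, hH, map_add, map_sub, map_smul]
  module

include hK in
theorem sugawaraTerm_md_F_zero (n : ℕ) (v : M) :
    sugawaraTerm M n (md M sl2F 0 v) = md M sl2F 0 (sugawaraTerm M n v) := by
  have hF (m : ℤ) (v : M) : md M sl2F m (md M sl2F 0 v) = md M sl2F 0 (md M sl2F m v) := by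
    rw [md_md hK, lie_self, ← zero_smul ℂ (0 : Sl2), md_smul]
    split_ifs with h <;> simp_all
  have hE (m : ℤ) (v : M) : md M sl2E m (md M sl2F 0 v) =
      md M sl2F 0 (md M sl2E m v) + md M sl2H m v := by
    rw [md_E_F hK, add_zero]
    split_ifs with h
    · subst h; simp
    · simp
  have hH (m : ℤ) (v : M) : md M sl2H m (md M sl2F 0 v) =
      md M sl2F 0 (md M sl2H m v) - (2 : ℂ) • md M sl2F m v := by
    rw [md_H_F hK, add_zero]
  simp only [sugawaraTerm_apply, hE, hF, hH, map_add, map_sub, map_smul]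
  module

/-- The operator `2 (e₋ₙ₋₁ fₙ - f₋ₙ₋₁ eₙ)`. -/
def sugawaraShift (n : ℕ) (v : M) : M :=
  (2 : ℂ) • md M sl2E (-n - 1) (md M sl2F n v) - (2 : ℂ) • md M sl2F (-n - 1) (md M sl2E n v)

include hK in
-- Moving `h₋₁` past `e` and `f` lowers one mode by one, so the resulting terms telescope in `n`.
-- The level enters only through `[h₁, h₋₁] = 2K`, in the term of mode `1`, that is `n = 0`.
theorem sugawaraTerm_succ_md_H (n : ℕ) (v : M) :
    sugawaraTerm M (n + 1) (md M sl2H (-1) v) = md M sl2H (-1) (sugawaraTerm M (n + 1) v) +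
      (sugawaraShift n v - sugawaraShift (n + 1) v) +
        (if n = 0 then k else 0) • md M sl2H (-1) v := by
  have hE (m : ℤ) (v : M) : md M sl2E m (md M sl2H (-1) v) =
      md M sl2H (-1) (md M sl2E m v) - (2 : ℂ) • md M sl2E (m - 1) v := md_E_H hK m (-1) v
  have hF (m : ℤ) (v : M) : md M sl2F m (md M sl2H (-1) v) =
      md M sl2H (-1) (md M sl2F m v) + (2 : ℂ) • md M sl2F (m - 1) v := md_F_H hK m (-1) v
  have hH (v : M) : md M sl2H ((n + 1 : ℕ) : ℤ) (md M sl2H (-1) v) =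
      md M sl2H (-1) (md M sl2H ((n + 1 : ℕ) : ℤ) v) + (if n = 0 then 2 * k else 0) • v := by
    rw [md_H_H hK]
    rcases eq_or_ne n 0 with rfl | hn
    · simp
    · rw [if_neg (by omega), if_neg hn]
  have hH' (v : M) : md M sl2H (-((n + 1 : ℕ) : ℤ)) (md M sl2H (-1) v) =
      md M sl2H (-1) (md M sl2H (-((n + 1 : ℕ) : ℤ)) v) := by
    rw [md_H_H hK, if_neg (by omega), zero_smul, add_zero]
  have h1 : ((n + 1 : ℕ) : ℤ) - 1 = n := by omega
  have h2 : -((n + 1 : ℕ) : ℤ) = -n - 1 := by omega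
  have h3 : (-(n : ℤ) - 1) = -((n + 1 : ℕ) : ℤ) := by omega
  simp only [sugawaraTerm_apply, sugawaraShift, hE, hF, hH, hH', map_add, map_sub, map_smul, h1]
  rw [h3]
  rcases eq_or_ne n 0 with rfl | hn
  · simp only [if_true, zero_add, Nat.cast_one]
    module
  · simp only [if_neg hn]
    module

include hK in
-- The coefficient `4` arises from bringing `2e₀f₋₁` and `-2f₀e₋₁` into the order used in
-- `sugawaraShift`, each contributing `2h₋₁`.
theorem sugawaraTerm_zero_md_H (v : M) :
    sugawaraTerm M 0 (md M sl2H (-1) v) = md M sl2H (-1) (sugawaraTerm M 0 v) -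
      (2 : ℂ) • sugawaraShift 0 v + (4 : ℂ) • md M sl2H (-1) v := by
  have hE (m : ℤ) (v : M) : md M sl2E m (md M sl2H (-1) v) =
      md M sl2H (-1) (md M sl2E m v) - (2 : ℂ) • md M sl2E (m - 1) v := md_E_H hK m (-1) v
  have hF (m : ℤ) (v : M) : md M sl2F m (md M sl2H (-1) v) =
      md M sl2H (-1) (md M sl2F m v) + (2 : ℂ) • md M sl2F (m - 1) v := md_F_H hK m (-1) v
  have hH (v : M) : md M sl2H 0 (md M sl2H (-1) v) = md M sl2H (-1) (md M sl2H 0 v) := by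
    rw [md_H_H hK, if_neg (by omega), zero_smul, add_zero]
  have hEF : md M sl2E 0 (md M sl2F (-1) v) =
      md M sl2F (-1) (md M sl2E 0 v) + md M sl2H (-1) v := by
    rw [md_E_F hK, if_neg (by omega), zero_smul, add_zero, zero_add]
  have hFE : md M sl2F 0 (md M sl2E (-1) v) =
      md M sl2E (-1) (md M sl2F 0 v) - md M sl2H (-1) v := by
    rw [md_E_F hK, if_neg (by omega), zero_smul, add_zero, add_zero, add_sub_cancel_right]
  simp only [sugawaraTerm_apply, sugawaraShift, Nat.cast_zero, neg_zero, zero_sub, hE, hF, hH,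
    hEF, hFE, map_add, map_sub, map_smul]
  module

variable [IsSmooth M]

theorem sugawaraL0_apply (k : ℂ) (v : M) : sugawaraL0 k M v = (1 / (2 * (k + 2))) •
    (sugawaraTerm M 0 v + (2 : ℂ) • ∑ᶠ n : ℕ, sugawaraTerm M (n + 1) v) := rfl

theorem exists_finsum_sugawaraTerm (v : M) : ∃ N₀ : ℕ, ∀ N ≥ N₀,
    ∑ᶠ n : ℕ, sugawaraTerm M (n + 1) v = ∑ n ∈ Finset.range N, sugawaraTerm M (n + 1) v := by
  obtain ⟨N₀, h⟩ := (sugawaraTerm_finite M v).bddAbove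
  refine ⟨N₀ + 1, fun N hN => finsum_eq_sum_of_support_subset _ fun n hn => ?_⟩
  have := h hn
  simp only [Finset.coe_range, Set.mem_Iio]
  omega

include hK in
theorem sugawaraL0_md_E_zero (v : M) :
    sugawaraL0 k M (md M sl2E 0 v) = md M sl2E 0 (sugawaraL0 k M v) := by
  simp only [sugawaraL0_apply, sugawaraTerm_md_E_zero hK, map_add, map_smul]
  rw [map_finsum _ (sugawaraTerm_finite M v)]

include hK in
theorem sugawaraL0_md_F_zero (v : M) :
    sugawaraL0 k M (md M sl2F 0 v) = md M sl2F 0 (sugawaraL0 k M v) := by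
  simp only [sugawaraL0_apply, sugawaraTerm_md_F_zero hK, map_add, map_smul]
  rw [map_finsum _ (sugawaraTerm_finite M v)]

include hK in
-- The boundary terms `-2 sugawaraShift 0` and `+2 sugawaraShift 0` cancel, and `4 + 2k` is exactly
-- the normalising factor `2(k+2)`.
theorem sugawaraL0_md_H (hk : k ≠ -2) (v : M) :
    sugawaraL0 k M (md M sl2H (-1) v) =
      md M sl2H (-1) (sugawaraL0 k M v) + md M sl2H (-1) v := by
  obtain ⟨N₁, h₁⟩ := exists_finsum_sugawaraTerm v
  obtain ⟨N₂, h₂⟩ := exists_finsum_sugawaraTerm (md M sl2H (-1) v)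
  obtain ⟨N₃, h₃⟩ := IsSmooth.eventually_zero sl2E v
  obtain ⟨N₄, h₄⟩ := IsSmooth.eventually_zero sl2F v
  -- One cutoff for both sums, beyond which the upper telescoping term vanishes; the `+ 1` puts the
  -- index `n = 0` in range.
  set N := N₁ + N₂ + N₃ + N₄ + 1 with hN
  have hshift : sugawaraShift N v = 0 := by
    rw [sugawaraShift, md, md, md, md, h₃ N (by omega), h₄ N (by omega)]
    simp
  have hk' : k + 2 ≠ 0 := fun h => hk (eq_neg_of_add_eq_zero_left h)
  rw [sugawaraL0_apply, sugawaraL0_apply, h₁ N (by omega), h₂ N (by omega),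
    sugawaraTerm_zero_md_H hK, Finset.sum_congr rfl fun n _ => sugawaraTerm_succ_md_H hK n v,
    Finset.sum_add_distrib, Finset.sum_add_distrib, Finset.sum_range_sub', hshift,
    ← Finset.sum_smul, Finset.sum_ite_eq', if_pos (Finset.mem_range.2 (by omega)), map_smul,
    map_add, map_smul, map_sum]
  match_scalars <;> field_simp <;> ring

include hK in
/-- The commutation relation `[L₀, x₋ₙ] = n x₋ₙ`. -/
theorem sugawaraL0_md (hk : k ≠ -2) (n : ℕ) (x : Sl2) (v : M) :
    sugawaraL0 k M (md M x (-n) v) = md M x (-n) (sugawaraL0 k M v) + (n : ℂ) • md M x (-n) v := by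
  -- Induction through `[h₋₁, e₋ₙ] = 2e₋ₙ₋₁` and `[h₋₁, f₋ₙ] = -2f₋ₙ₋₁`, starting from the zero
  -- modes.
  have hEF (n : ℕ) : (∀ v, sugawaraL0 k M (md M sl2E (-n) v) =
        md M sl2E (-n) (sugawaraL0 k M v) + (n : ℂ) • md M sl2E (-n) v) ∧
      (∀ v, sugawaraL0 k M (md M sl2F (-n) v) =
        md M sl2F (-n) (sugawaraL0 k M v) + (n : ℂ) • md M sl2F (-n) v) := by
    induction n with
    | zero => simp [sugawaraL0_md_E_zero hK, sugawaraL0_md_F_zero hK]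
    | succ n ih =>
      have hn : -((n + 1 : ℕ) : ℤ) = -1 + -n := by omega
      have hE (v : M) : md M sl2E (-((n + 1 : ℕ) : ℤ)) v = (1 / 2 : ℂ) •
          (md M sl2H (-1) (md M sl2E (-n) v) - md M sl2E (-n) (md M sl2H (-1) v)) := by
        rw [md_H_E hK, ← hn]; module
      have hF (v : M) : md M sl2F (-((n + 1 : ℕ) : ℤ)) v = (1 / 2 : ℂ) •
          (md M sl2F (-n) (md M sl2H (-1) v) - md M sl2H (-1) (md M sl2F (-n) v)) := by
        rw [md_H_F hK, ← hn]; module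
      refine ⟨fun v => ?_, fun v => ?_⟩
      · simp only [hE, map_sub, map_smul, sugawaraL0_md_H hK hk, ih.1, map_add]
        push_cast
        module
      · simp only [hF, map_sub, map_smul, sugawaraL0_md_H hK hk, ih.2, map_add]
        push_cast
        module
  have hH (v : M) : sugawaraL0 k M (md M sl2H (-n) v) =
      md M sl2H (-n) (sugawaraL0 k M v) + (n : ℂ) • md M sl2H (-n) v := by
    -- `h₋ₙ = [e₀, f₋ₙ]`, and `e₀` commutes with `L₀`.
    have h (v : M) : md M sl2H (-n) v =
        md M sl2E 0 (md M sl2F (-n) v) - md M sl2F (-n) (md M sl2E 0 v) := by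
      rw [md_E_F hK, zero_add]; simp
    simp only [h, map_sub, sugawaraL0_md_E_zero hK, (hEF n).2, map_add, map_smul]
    module
  have hx := sl2_eq_sum x
  -- The coordinates must no longer mention `x` before `x` can be eliminated.
  generalize sl2Entry 0 1 x = a at hx
  generalize sl2Entry 0 0 x = b at hx
  generalize sl2Entry 1 0 x = c at hx
  subst hx
  simp only [md_add, md_smul, map_add, map_smul, (hEF n).1, (hEF n).2, hH]
  module

end Sugawara

/-! ### Weights of monomials -/

/-- Each variable shifts the eigenvalue of `D` by a fixed amount, so ordered monomials are
eigenvectors. It serves `h₀`, the Sugawara `L₀`, the Virasoro `L₀` and `K`. -/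
theorem IsInduced.eigen_basis {N : Type} [LinearOrder N] {g : Type} [LieRing g] [LieAlgebra ℂ g]
    {x : N → g} {π : g →ₗ[ℂ] N →₀ ℂ} {χ : g →ₗ[ℂ] ℂ} {S : Set (g × ℂ)} (H : IsInduced x π χ S)
    (D : Module.End ℂ (CyclicModule S)) (α : N → ℂ) (c : ℂ)
    (hD : ∀ i v, D (act g (CyclicModule S) (x i) v) =
      act g (CyclicModule S) (x i) (D v) + α i • act g (CyclicModule S) (x i) v)
    (hgen : D (CyclicModule.gen S) = c • CyclicModule.gen S) (s : Multiset N) :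
    D (H.basis s) = (c + (s.map α).sum) • H.basis s := by
  induction hn : s.card generalizing s with
  | zero =>
    rw [Multiset.card_eq_zero.1 hn, H.basis_apply, envMon_zero, one_smul, hgen]
    simp
  | succ n ih =>
    induction s using multiset_min_induction with
    | h0 => simp at hn
    | hcons j t h =>
      have hj : H.basis (j ::ₘ t) = act g (CyclicModule S) (x j) (H.basis t) := by
        rw [H.basis_apply, H.basis_apply, envMon_cons h, mul_smul]
        rfl
      rw [hj, hD, ih t (by simpa using hn), map_smul, ← add_smul, Multiset.map_cons,
        Multiset.sum_cons]
      congr 1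
      ring

/-! ### Operators that are diagonal in a basis. -/

section Basis

variable {I M : Type} [AddCommGroup M] [Module ℂ M] (b : Module.Basis I ℂ M)

/-- The span of the basis vectors with indices in a set. -/
def basisSpan (s : Set I) : Submodule ℂ M :=
  (Finsupp.supported ℂ ℂ s).comap (b.repr : M →ₗ[ℂ] I →₀ ℂ)

theorem mem_basisSpan {s : Set I} {v : M} : v ∈ basisSpan b s ↔ ∀ p, b.repr v p ≠ 0 → p ∈ s := by
  rw [basisSpan, Submodule.mem_comap, Finsupp.mem_supported]
  exact ⟨fun h p hp => h (Finsupp.mem_support_iff.2 hp),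
    fun h p hp => h p (Finsupp.mem_support_iff.1 hp)⟩

theorem basis_mem_basisSpan {s : Set I} {p : I} (hp : p ∈ s) : b p ∈ basisSpan b s := by
  classical
  rw [mem_basisSpan]
  intro q hq
  rw [b.repr_self, Finsupp.single_apply] at hq
  rwa [← (ite_ne_right_iff.1 hq).1]

/-- The span of a set of basis vectors as a space of coordinates. -/
def basisSpanEquiv (s : Set I) : basisSpan b s ≃ₗ[ℂ] s →₀ ℂ :=
  (LinearEquiv.ofSubmodule' b.repr _).trans (Finsupp.supportedEquivFinsupp s)

theorem finiteDimensional_basisSpan {s : Set I} (hs : s.Finite) :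
    FiniteDimensional ℂ (basisSpan b s) :=
  have := hs.to_subtype
  Module.Finite.equiv (basisSpanEquiv b s).symm

theorem finrank_basisSpan {s : Set I} (hs : s.Finite) :
    Module.finrank ℂ (basisSpan b s) = s.ncard := by
  have := hs.fintype
  rw [(basisSpanEquiv b s).finrank_eq, Module.finrank_finsupp_self, Set.ncard_eq_toFinset_card',
    Set.toFinset_card]

/-- `D` multiplies the coordinate at `p` by `a p`, so an eigenvector for `c` has no coordinate where
`a p ≠ c`. -/
theorem eigenspace_eq_basisSpan {D : Module.End ℂ M} {a : I → ℂ} (hD : ∀ p, D (b p) = a p • b p)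
    (c : ℂ) : D.eigenspace c = basisSpan b {p | a p = c} := by
  classical
  have h (v : M) (p : I) : b.repr (D v) p = a p * b.repr v p := by
    refine LinearMap.congr_fun (f := b.coord p ∘ₗ D) (g := a p • b.coord p) (b.ext fun q => ?_) v
    simp only [LinearMap.comp_apply, hD, map_smul, Module.Basis.coord_apply, LinearMap.smul_apply,
      b.repr_self, Finsupp.single_apply, smul_eq_mul]
    split_ifs with hq
    · rw [hq]
    · simp
  ext v
  rw [Module.End.mem_eigenspace_iff, mem_basisSpan, ← b.repr.injective.eq_iff, Finsupp.ext_iff]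
  refine forall_congr' fun p => ?_
  rw [h, map_smul, Finsupp.smul_apply, smul_eq_mul, mul_eq_mul_right_iff, or_iff_not_imp_right]
  rfl

theorem basisSpan_inf (s s' : Set I) : basisSpan b s ⊓ basisSpan b s' = basisSpan b (s ∩ s') := by
  ext v
  simp only [Submodule.mem_inf, mem_basisSpan, Set.mem_inter_iff]
  exact ⟨fun h p hp => ⟨h.1 p hp, h.2 p hp⟩, fun h => ⟨fun p hp => (h p hp).1,
    fun p hp => (h p hp).2⟩⟩

theorem iSup_basisSpan_eq_top {κ : Type} (w : I → κ) : ⨆ q, basisSpan b {p | w p = q} = ⊤ := by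
  rw [eq_top_iff, ← b.span_eq, Submodule.span_le]
  rintro _ ⟨p, rfl⟩
  exact Submodule.mem_iSup_of_mem (w p) (basis_mem_basisSpan b rfl)

end Basis

theorem act_zero {g : Type} [LieRing g] [LieAlgebra ℂ g] {M : Type} [AddCommGroup M] [Module ℂ M]
    [Module (UniversalEnvelopingAlgebra ℂ g) M] [IsScalarTower ℂ (UniversalEnvelopingAlgebra ℂ g) M]
    (v : M) : act g M 0 v = 0 := by
  simp only [act, map_zero, LinearMap.zero_apply]

theorem act_lie_mode {M : Type} [AddCommGroup M] [Module ℂ M]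
    [Module (UniversalEnvelopingAlgebra ℂ AffineSl2) M]
    [IsScalarTower ℂ (UniversalEnvelopingAlgebra ℂ AffineSl2) M] {x y : Sl2} {a : ℂ}
    (h : ⁅y, x⁆ = a • x) (n : ℤ) (v : M) :
    act AffineSl2 M ⁅mode y 0, mode x n⁆ v = a • act AffineSl2 M (mode x n) v := by
  rw [lie_mode_mode, h, Int.cast_zero, zero_mul, ite_self, zero_smul, add_zero, zero_add, mode_smul,
    act_smul]

theorem act_gen {g : Type} [LieRing g] [LieAlgebra ℂ g] {S : Set (g × ℂ)} {y : g} {a : ℂ}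
    (h : (y, a) ∈ S) :
    act g (CyclicModule S) y (CyclicModule.gen S) = a • CyclicModule.gen S :=
  gen_rel h

theorem Exponents.sum_map_varDegree (p : Exponents) :
    ((equivMultiset p).map fun a => (varDegree a : ℂ)).sum = p.degree := by
  rw [degree, ← Nat.coe_castRingHom, map_multiset_sum, Multiset.map_map]
  rfl

theorem Exponents.finite_add_degree (h m : ℂ) : {p : Exponents | h + p.degree = m}.Finite := by
  rcases Set.eq_empty_or_nonempty {p : Exponents | h + p.degree = m} with he | ⟨p₀, hp₀⟩
  · rw [he]
    exact Set.finite_empty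
  · refine (finite_degree p₀.degree).subset fun p hp => ?_
    have : h + (p.degree : ℂ) = h + p₀.degree := hp.trans hp₀.symm
    exact Nat.cast_injective (add_left_cancel this)

theorem virasoroWeightSpace_eq (c h m : ℂ) : virasoroWeightSpace (VirasoroVerma c h) m =
    basisSpan (virasoroBasis c h) {p | h + p.degree = m} := by
  refine eigenspace_eq_basisSpan _ (fun p => ?_) m
  rw [virasoroBasis, Module.Basis.reindex_apply, Equiv.symm_symm, ← p.sum_map_varDegree]
  refine (virasoro_isInduced c h).eigen_basis _ _ _ (fun a v => ?_)
    (act_gen (Or.inl (Or.inr rfl))) _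
  have := varDegree_pos a
  rw [virasoroVar_eq, act_act, Virasoro.lie_L_L, if_neg (by omega), zero_smul, add_zero, act_smul,
    zero_add]
  simp

theorem hasVirasoroCharacter (c h : ℂ) : HasVirasoroCharacter (VirasoroVerma c h) := by
  refine ⟨?_, fun m => ?_⟩
  · simp only [virasoroWeightSpace_eq]
    exact iSup_basisSpan_eq_top _ _
  · rw [virasoroWeightSpace_eq]
    exact finiteDimensional_basisSpan _ (Exponents.finite_add_degree h m)

/-! ### Weights, characters and the comparison map for a triple. -/

namespace Triple

variable (t : Triple) {k ν : ℂ}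

theorem act_centralK (v : CyclicModule (t.relations k ν)) :
    act AffineSl2 (CyclicModule (t.relations k ν)) centralK v = k • v := by
  have h (s : Multiset (WithTop ℕ)) := (t.isInduced k ν).eigen_basis
    (act AffineSl2 (CyclicModule (t.relations k ν)) centralK) (fun _ => 0) k
    (fun a v => by rw [act_act, centralK_lie, act_zero, zero_smul])
    (act_gen (Or.inl (Or.inl rfl))) s
  simp only [Multiset.map_const', Multiset.sum_replicate, smul_zero, add_zero] at h
  exact LinearMap.congr_fun (f := act AffineSl2 (CyclicModule (t.relations k ν)) centralK)
    (g := k • LinearMap.id) ((t.isInduced k ν).basis.ext h) v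

/-- The change of the `h₀`-weight by a variable. -/
def varH : WithTop ℕ → ℂ :=
  interleave (fun _ => 2 * t.sign) (fun _ => 0) (fun _ => -2 * t.sign) (-2 * t.sign)

/-- The change of the `L₀`-weight by a variable. -/
def varL : WithTop ℕ → ℂ :=
  interleave (fun i => (i + 1 : ℕ)) (fun i => (i + 1 : ℕ)) (fun i => (i + 1 : ℕ)) (0 : ℕ)

/-- The arithmetic core: the substitution `w ↦ q^(-sign/2)`, `q ↦ q³` turns the affine weights of
the variables into the degrees `1, 2, 3, …`, each taken once. -/
theorem varDegree_eq (a : WithTop ℕ) : (varDegree a : ℂ) = -(t.sign / 2) * t.varH a + 3 * varL a := by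
  induction a using withTop_cases <;>
    simp only [varH, varL, interleave_top, interleave_zero, interleave_one, interleave_two,
      varDegree_top, varDegree_coe] <;> push_cast
  · linear_combination -t.sign_sq
  · linear_combination t.sign_sq
  · ring
  · linear_combination -t.sign_sq

/-- The `h₀`-weight of a monomial. -/
def weightH (ν : ℂ) (p : Exponents) : ℂ := ν + ((Exponents.equivMultiset p).map t.varH).sum

/-- The `L₀`-weight of a monomial. -/
def weightL (Δ : ℂ) (p : Exponents) : ℂ := Δ + ((Exponents.equivMultiset p).map varL).sum

theorem degree_eq (p : Exponents) (Δ : ℂ) :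
    -(t.sign / 2) * t.weightH ν p + 3 * weightL Δ p = -(t.sign / 2) * ν + 3 * Δ + p.degree := by
  rw [← p.sum_map_varDegree, weightH, weightL]
  simp only [t.varDegree_eq, Multiset.sum_map_add, Multiset.sum_map_mul_left]
  ring

theorem act_H_basis (p : Exponents) (hH : t.H = sl2H) :
    act AffineSl2 (CyclicModule (t.relations k ν)) (mode sl2H 0) (t.basis k ν p) =
      t.weightH ν p • t.basis k ν p := by
  rw [basis, Module.Basis.reindex_apply, Equiv.symm_symm]
  refine (t.isInduced k ν).eigen_basis _ _ _ (fun a v => ?_)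
    (act_gen (Or.inl (Or.inr (Or.inl (by rw [hH]))))) _
  rw [act_act, ← hH]
  congr 1
  induction a using withTop_cases with
  | htop => exact act_lie_mode t.lie_HF 0 v
  | h0 i =>
    simp only [var, varH, interleave_zero]
    exact act_lie_mode t.lie_HE _ v
  | h1 i =>
    simp only [var, varH, interleave_one]
    exact act_lie_mode (by rw [lie_self, zero_smul]) _ v
  | h2 i =>
    simp only [var, varH, interleave_two]
    exact act_lie_mode t.lie_HF _ v

instance : IsSmooth (CyclicModule (t.relations k ν)) :=
  isSmooth_cyclicModule _ fun x n => Or.inr ⟨x, n, rfl⟩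


theorem sugawaraL0_basis (hk : k ≠ -2) {Δ : ℂ} (hΔ : sugawaraL0 k (CyclicModule (t.relations k ν))
    (CyclicModule.gen _) = Δ • CyclicModule.gen _) (p : Exponents) :
    sugawaraL0 k (CyclicModule (t.relations k ν)) (t.basis k ν p) =
      weightL Δ p • t.basis k ν p := by
  rw [basis, Module.Basis.reindex_apply, Equiv.symm_symm]
  refine (t.isInduced k ν).eigen_basis _ _ _ (fun a v => ?_) hΔ _
  have h (n : ℕ) (x : Sl2) := sugawaraL0_md t.act_centralK hk n x v
  induction a using withTop_cases with
  | htop => exact h 0 t.F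
  | h0 i => simpa only [var, varL, interleave_zero, Nat.cast_add, Nat.cast_one] using h (i + 1) t.E
  | h1 i => simpa only [var, varL, interleave_one, Nat.cast_add, Nat.cast_one] using h (i + 1) t.H
  | h2 i => simpa only [var, varL, interleave_two, Nat.cast_add, Nat.cast_one] using h (i + 1) t.F

theorem affineWeightSpace_eq (hH : t.H = sl2H) (hk : k ≠ -2) {Δ : ℂ}
    (hΔ : sugawaraL0 k (CyclicModule (t.relations k ν)) (CyclicModule.gen _) =
      Δ • CyclicModule.gen _) (f n : ℂ) :
    affineWeightSpace k (CyclicModule (t.relations k ν)) f n =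
      basisSpan (t.basis k ν) {p | (t.weightH ν p, weightL Δ p) = (f, n)} := by
  rw [affineWeightSpace, eigenspace_eq_basisSpan _ (fun p => t.act_H_basis p hH),
    eigenspace_eq_basisSpan _ (t.sugawaraL0_basis hk hΔ), basisSpan_inf]
  congr 1
  ext p
  simp

theorem finite_weight (Δ : ℂ) (q : ℂ × ℂ) :
    {p | (t.weightH ν p, weightL Δ p) = q}.Finite := by
  refine (Exponents.finite_add_degree (-(t.sign / 2) * ν + 3 * Δ)
    (-(t.sign / 2) * q.1 + 3 * q.2)).subset fun p hp => ?_
  rw [Set.mem_ofPred_eq] at hp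
  rw [Set.mem_ofPred_eq, ← t.degree_eq, ← hp]

theorem hasAffineCharacter (hH : t.H = sl2H) (hk : k ≠ -2) {Δ : ℂ}
    (hΔ : sugawaraL0 k (CyclicModule (t.relations k ν)) (CyclicModule.gen _) =
      Δ • CyclicModule.gen _) :
    HasAffineCharacter k (CyclicModule (t.relations k ν)) := by
  refine ⟨?_, fun f n => ?_⟩
  · simp only [t.affineWeightSpace_eq hH hk hΔ]
    exact iSup_basisSpan_eq_top _ _
  · rw [t.affineWeightSpace_eq hH hk hΔ]
    exact finiteDimensional_basisSpan _ (t.finite_weight Δ _)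

theorem affineCharacter_eq (hH : t.H = sl2H) (hk : k ≠ -2) {Δ : ℂ}
    (hΔ : sugawaraL0 k (CyclicModule (t.relations k ν)) (CyclicModule.gen _) =
      Δ • CyclicModule.gen _) (f n : ℂ) :
    affineCharacter k (CyclicModule (t.relations k ν)) f n =
      {p | (t.weightH ν p, weightL Δ p) = (f, n)}.ncard := by
  rw [affineCharacter, t.affineWeightSpace_eq hH hk hΔ, finrank_basisSpan _ (t.finite_weight Δ _)]

theorem canSubstitute (hH : t.H = sl2H) (hk : k ≠ -2) {Δ : ℂ}
    (hΔ : sugawaraL0 k (CyclicModule (t.relations k ν)) (CyclicModule.gen _) =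
      Δ • CyclicModule.gen _) :
    CanSubstitute (affineCharacter k (CyclicModule (t.relations k ν))) (-(t.sign / 2)) 3 := by
  intro m
  refine ((Exponents.finite_add_degree (-(t.sign / 2) * ν + 3 * Δ) m).image
    fun p => (t.weightH ν p, weightL Δ p)).subset ?_
  rintro ⟨f, n⟩ ⟨hm, hne⟩
  rw [t.affineCharacter_eq hH hk hΔ] at hne
  obtain ⟨p, hp⟩ := Set.nonempty_of_ncard_ne_zero hne
  refine ⟨p, ?_, hp⟩
  obtain ⟨hf, hn⟩ := Prod.mk.inj hp
  rw [Set.mem_ofPred_eq, ← t.degree_eq, hf, hn]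
  exact hm

/-- Both sides count monomials of one fixed degree; the left side groups them by joint weight, which
determines the degree by `degree_eq`. -/
theorem substitute_eq (hH : t.H = sl2H) (hk : k ≠ -2) {Δ : ℂ}
    (hΔ : sugawaraL0 k (CyclicModule (t.relations k ν)) (CyclicModule.gen _) =
      Δ • CyclicModule.gen _) (c : ℂ) :
    substitute (affineCharacter k (CyclicModule (t.relations k ν))) (-(t.sign / 2)) 3 =
      virasoroCharacter (VirasoroVerma c (-(t.sign / 2) * ν + 3 * Δ)) := by
  classical
  ext m
  have hfin := Exponents.finite_add_degree (-(t.sign / 2) * ν + 3 * Δ) m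
  rw [virasoroCharacter, virasoroWeightSpace_eq, finrank_basisSpan _ hfin,
    Set.ncard_eq_toFinset_card _ hfin, substitute,
    Finset.card_eq_sum_card_image (fun p => (t.weightH ν p, weightL Δ p)) hfin.toFinset]
  -- The contribution of `q` is the fibre of the joint weight over `q`, and this fibre is empty
  -- unless `q` lies on the line of the substitution.
  have hterm (q : ℂ × ℂ) : (∑ᶠ _ : -(t.sign / 2) * q.1 + 3 * q.2 = m,
      affineCharacter k (CyclicModule (t.relations k ν)) q.1 q.2) =
        (hfin.toFinset.filter fun p => (t.weightH ν p, weightL Δ p) = q).card := by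
    rw [t.affineCharacter_eq hH hk hΔ, finsum_eq_if]
    split_ifs with hq
    · rw [← Set.ncard_coe_finset]
      congr 1
      ext p
      simp only [Set.mem_ofPred_eq, Finset.coe_filter, Set.Finite.mem_toFinset]
      refine ⟨fun h => ⟨?_, h⟩, fun h => h.2⟩
      obtain ⟨h₁, h₂⟩ := Prod.mk.inj h
      rw [← t.degree_eq, ← hq, h₁, h₂]
    · symm
      rw [Finset.card_eq_zero, Finset.filter_eq_empty_iff]
      intro p hp h
      rw [Set.Finite.mem_toFinset, Set.mem_ofPred_eq, ← t.degree_eq] at hp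
      exact hq (by rw [← h]; exact hp)
  rw [finsum_congr hterm]
  refine finsum_eq_sum_of_support_subset _ fun q hq => ?_
  rw [Function.mem_support, Finset.card_ne_zero] at hq
  obtain ⟨p, hp⟩ := hq
  rw [Finset.mem_filter] at hp
  exact Finset.mem_coe.2 (Finset.mem_image.2 ⟨p, hp⟩)

theorem exists_basis_equiv (hH : t.H = sl2H) (hk : k ≠ -2) {Δ : ℂ}
    (hΔ : sugawaraL0 k (CyclicModule (t.relations k ν)) (CyclicModule.gen _) =
      Δ • CyclicModule.gen _) (c : ℂ) {h : ℂ} (hh : h = -(t.sign / 2) * ν + 3 * Δ) :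
    ∃ b : Module.Basis Exponents ℂ (CyclicModule (t.relations k ν)),
      (∀ p, b p = orderedProduct (fun i => affineU t.E (-(i + 1)))
        (fun i => affineU t.H (-(i + 1))) (fun i => affineU t.F (-(i + 1))) (affineU t.F 0) p •
          CyclicModule.gen (t.relations k ν)) ∧
    ∃ φ : CyclicModule (t.relations k ν) ≃ₗ[ℂ] VirasoroVerma c h,
      (∀ p, φ (b p) = virasoroMonomial c h p) ∧
      ∀ f n : ℂ, ∀ x ∈ affineWeightSpace k (CyclicModule (t.relations k ν)) f n,
        φ x ∈ virasoroWeightSpace (VirasoroVerma c h) (-(t.sign / 2) * f + 3 * n) := by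
  subst hh
  refine ⟨t.basis k ν, t.basis_apply k ν, (t.basis k ν).equiv (virasoroBasis c _) (Equiv.refl _), fun p => ?_, fun f n x hx => ?_⟩
  · rw [Module.Basis.equiv_apply, Equiv.refl_apply, virasoroBasis_apply]
  · rw [t.affineWeightSpace_eq hH hk hΔ, mem_basisSpan] at hx
    rw [virasoroWeightSpace_eq, mem_basisSpan]
    intro p hp
    -- The map carries basis to basis with the same index, so coordinates are unchanged and weights
    -- can be compared index by index.
    have hr : (virasoroBasis c (-(t.sign / 2) * ν + 3 * Δ)).repr
        ((t.basis k ν).equiv (virasoroBasis c _) (Equiv.refl _) x) = (t.basis k ν).repr x := by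
      simp [Module.Basis.equiv]
    rw [hr] at hp
    obtain ⟨hf, hn⟩ := Prod.mk.inj (hx p hp)
    rw [Set.mem_ofPred_eq, ← t.degree_eq, hf, hn]

/-- The comparison of the Verma module attached to a triple with the Virasoro Verma module. -/
theorem comparison {S : Set (AffineSl2 × ℂ)} [IsSmooth (CyclicModule S)]
    (hS : S = t.relations k ν) (hH : t.H = sl2H) (hk : k ≠ -2) {Δ a : ℂ}
    (hΔ : sugawaraL0 k (CyclicModule S) (CyclicModule.gen _) = Δ • CyclicModule.gen _) (c : ℂ)
    {h : ℂ} (ha : a = -(t.sign / 2)) (hh : h = a * ν + 3 * Δ) :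
    (∃ b : Module.Basis Exponents ℂ (CyclicModule S),
      (∀ p, b p = orderedProduct (fun i => affineU t.E (-(i + 1)))
        (fun i => affineU t.H (-(i + 1))) (fun i => affineU t.F (-(i + 1))) (affineU t.F 0) p •
          CyclicModule.gen S) ∧
      ∃ φ : CyclicModule S ≃ₗ[ℂ] VirasoroVerma c h, (∀ p, φ (b p) = virasoroMonomial c h p) ∧
        ∀ f n : ℂ, ∀ x ∈ affineWeightSpace k (CyclicModule S) f n,
          φ x ∈ virasoroWeightSpace (VirasoroVerma c h) (a * f + 3 * n)) ∧
    HasAffineCharacter k (CyclicModule S) ∧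
    CanSubstitute (affineCharacter k (CyclicModule S)) a 3 ∧
    substitute (affineCharacter k (CyclicModule S)) a 3 =
      virasoroCharacter (VirasoroVerma c h) := by
  subst hS ha hh
  exact ⟨t.exists_basis_equiv hH hk hΔ c rfl, t.hasAffineCharacter hH hk hΔ,
    t.canSubstitute hH hk hΔ, t.substitute_eq hH hk hΔ c⟩

end Triple

/-! ### The generators -/

/-- Positive modes kill the generator and stand on the right in every term with `n ≥ 1`, so only the
zero-mode Casimir term survives. -/
theorem sugawaraL0_gen {S : Set (AffineSl2 × ℂ)} [IsSmooth (CyclicModule S)] (k : ℂ) {d : ℂ}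
    (hS : ∀ (x : Sl2) (n : ℕ), (mode x (n + 1), (0 : ℂ)) ∈ S)
    (h0 : sugawaraTerm (CyclicModule S) 0 (CyclicModule.gen S) = d • CyclicModule.gen S) :
    sugawaraL0 k (CyclicModule S) (CyclicModule.gen S) =
      (d / (2 * (k + 2))) • CyclicModule.gen S := by
  have h (n : ℕ) : sugawaraTerm (CyclicModule S) (n + 1) (CyclicModule.gen S) = 0 := by
    have hx (x : Sl2) : md (CyclicModule S) x ((n + 1 : ℕ) : ℤ) (CyclicModule.gen S) = 0 := by
      rw [md, Nat.cast_succ, act_gen (hS x n), zero_smul]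
    simp only [sugawaraTerm_apply, hx, map_zero, smul_zero, add_zero]
  rw [sugawaraL0_apply, h0, finsum_congr h, finsum_zero, smul_zero, add_zero, smul_smul]
  congr 1
  ring

theorem sugawaraL0_gen_highest (k μ : ℂ) :
    sugawaraL0 k (AffineVerma k μ) (CyclicModule.gen _) =
      ((μ + μ ^ 2 / 2) / (2 * (k + 2))) • CyclicModule.gen _ := by
  refine sugawaraL0_gen k (fun x n => Or.inr ⟨x, n, rfl⟩) ?_
  have hE : md (AffineVerma k μ) sl2E 0 (CyclicModule.gen _) = (0 : ℂ) • CyclicModule.gen _ :=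
    act_gen (Or.inl (Or.inr (Or.inr rfl)))
  have hH : md (AffineVerma k μ) sl2H 0 (CyclicModule.gen _) = μ • CyclicModule.gen _ :=
    act_gen (Or.inl (Or.inr (Or.inl rfl)))
  have hK : ∀ v : AffineVerma k μ, act AffineSl2 (AffineVerma k μ) centralK v = k • v :=
    tripleEHF.act_centralK
  simp only [sugawaraTerm_apply, Nat.cast_zero, neg_zero]
  rw [md_E_F hK]
  simp only [add_zero, hE, hH, map_smul, zero_smul, map_zero, Int.cast_zero, zero_mul, ite_self]
  module

/-- Here `e₀f₀` kills the generator and `f₀e₀` acts as `-h₀`. At `ν = -μ` the weight agrees with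
that of the highest-weight generator. -/
theorem sugawaraL0_gen_lowest (k ν : ℂ) :
    sugawaraL0 k (AffineVermaLowest k ν) (CyclicModule.gen _) =
      ((-ν + ν ^ 2 / 2) / (2 * (k + 2))) • CyclicModule.gen _ := by
  refine sugawaraL0_gen k (fun x n => Or.inr ⟨x, n, rfl⟩) ?_
  have hF : md (AffineVermaLowest k ν) sl2F 0 (CyclicModule.gen _) = (0 : ℂ) • CyclicModule.gen _ :=
    act_gen (Or.inl (Or.inr (Or.inr rfl)))
  have hH : md (AffineVermaLowest k ν) sl2H 0 (CyclicModule.gen _) = ν • CyclicModule.gen _ :=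
    act_gen (Or.inl (Or.inr (Or.inl rfl)))
  have hK : ∀ v : AffineVermaLowest k ν, act AffineSl2 (AffineVermaLowest k ν) centralK v = k • v :=
    tripleFHE.act_centralK
  have hEF := md_E_F hK 0 0
    (CyclicModule.gen (lowestRelations k ν))
  simp only [sugawaraTerm_apply, Nat.cast_zero, neg_zero]
  simp only [add_zero, hF, hH, map_smul, zero_smul, map_zero, Int.cast_zero, zero_mul,
    ite_self] at hEF ⊢
  rw [eq_neg_of_add_eq_zero_left hEF.symm]
  module

end AffVir

end

theorem mainTheorem3 (k μ c h : ℂ) (hk : k ≠ -2)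
    (hh : h = μ * (3 * μ + 2 - 2 * k) / (4 * (k + 2))) :
    -- the map `φ⁺` on the highest-weight Verma module `M_k(μ)`
    (∃ b : Module.Basis AffVir.Exponents ℂ (AffVir.AffineVerma k μ),
      (∀ p, b p = AffVir.affineMonomial k μ p) ∧
      ∃ φ : AffVir.AffineVerma k μ ≃ₗ[ℂ] AffVir.VirasoroVerma c h,
        (∀ p, φ (b p) = AffVir.virasoroMonomial c h p) ∧
        ∀ (f n : ℂ), ∀ x ∈ AffVir.affineWeightSpace k (AffVir.AffineVerma k μ) f n,
          φ x ∈ AffVir.virasoroWeightSpace (AffVir.VirasoroVerma c h) (-f / 2 + 3 * n)) ∧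
    -- the map `φ⁻` on the lowest-weight Verma module `M⁻_k(-μ)`
    (∃ b : Module.Basis AffVir.Exponents ℂ (AffVir.AffineVermaLowest k (-μ)),
      (∀ p, b p = AffVir.affineMonomialLowest k (-μ) p) ∧
      ∃ φ : AffVir.AffineVermaLowest k (-μ) ≃ₗ[ℂ] AffVir.VirasoroVerma c h,
        (∀ p, φ (b p) = AffVir.virasoroMonomial c h p) ∧
        ∀ (f n : ℂ), ∀ x ∈ AffVir.affineWeightSpace k (AffVir.AffineVermaLowest k (-μ)) f n,
          φ x ∈ AffVir.virasoroWeightSpace (AffVir.VirasoroVerma c h) (f / 2 + 3 * n)) ∧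
    -- the formal characters are defined
    AffVir.HasAffineCharacter k (AffVir.AffineVerma k μ) ∧
    AffVir.HasAffineCharacter k (AffVir.AffineVermaLowest k (-μ)) ∧
    AffVir.HasVirasoroCharacter (AffVir.VirasoroVerma c h) ∧
    -- the character identity for `M_k(μ)`
    (AffVir.CanSubstitute (AffVir.affineCharacter k (AffVir.AffineVerma k μ)) (-1 / 2) 3 ∧
      AffVir.substitute (AffVir.affineCharacter k (AffVir.AffineVerma k μ)) (-1 / 2) 3 =
        AffVir.virasoroCharacter (AffVir.VirasoroVerma c h)) ∧
    -- the character identity for `M⁻_k(-μ)`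
    (AffVir.CanSubstitute (AffVir.affineCharacter k (AffVir.AffineVermaLowest k (-μ))) (1 / 2) 3 ∧
      AffVir.substitute (AffVir.affineCharacter k (AffVir.AffineVermaLowest k (-μ))) (1 / 2) 3 =
        AffVir.virasoroCharacter (AffVir.VirasoroVerma c h)) := by
  have hk' : k + 2 ≠ 0 := fun h => hk (eq_neg_of_add_eq_zero_left h)
  have hΔ₁ := AffVir.sugawaraL0_gen_highest k μ
  have hΔ₂ := AffVir.sugawaraL0_gen_lowest k (-μ)
  -- The last side condition is `h = -μ/2 + 3Δ`, the origin of the formula for `h`; the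
  -- lowest-weight case gives the same number as `½(-μ) + 3Δ`.
  obtain ⟨⟨b₁, hb₁, φ₁, hφ₁, hw₁⟩, hc₁, hs₁, he₁⟩ := AffVir.tripleEHF.comparison
    (S := AffVir.highestRelations k μ) (a := -1 / 2) (h := h) rfl rfl hk hΔ₁ c
    (by rw [AffVir.tripleEHF]; ring) (by rw [hh]; field_simp; ring)
  obtain ⟨⟨b₂, hb₂, φ₂, hφ₂, hw₂⟩, hc₂, hs₂, he₂⟩ := AffVir.tripleFHE.comparison
    (S := AffVir.lowestRelations k (-μ)) (a := 1 / 2) (h := h) rfl rfl hk hΔ₂ c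
    (by rw [AffVir.tripleFHE]; ring) (by rw [hh]; field_simp; ring)
  refine ⟨⟨b₁, hb₁, φ₁, hφ₁, fun f n x hx => ?_⟩, ⟨b₂, hb₂, φ₂, hφ₂, fun f n x hx => ?_⟩, hc₁, hc₂,
    AffVir.hasVirasoroCharacter c h, ⟨hs₁, he₁⟩, ⟨hs₂, he₂⟩⟩
  · rw [show -f / 2 = -1 / 2 * f by ring]
    exact hw₁ f n x hx
  · rw [show f / 2 = 1 / 2 * f by ring]
    exact hw₂ f n x hx
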